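/- **Theorem 2.2 (law of large numbers).** Fix integers $1\le k\le L$ and $c\ge 1$, a rate $\lambda>0$ and a horizon $T\in[0,\infty)$. For each $n\ge L$ consider the following system of $n$ servers, each with its own infinite-capacity queue. Files are stored on the servers so that each file is stored at exactly $L$ servers and each set of $L$ servers holds exactly $c$ files. Requests arrive according to a Poisson process with rate $n\lambda$, and each requests one of the files uniformly at random; one job is then sent to each of the $k$ shortest queues among the $L$ servers that hold this file (ties are broken by an arbitrary, possibly randomized, rule that depends on the current queue lengths and on this set of servers). Each server processes its queue in first-in-first-out order; processing times are independent and exponential with mean $1/k$. Let $Q^n(t)=(Q^n_1(t),\dots,Q^n_n(t))$ be the queue lengths at time $t\in[0,T]$, started from a nonrandom $Q^n(0)=q^n\in\mathbb{N}_0^n$; equivalently, $Q^n$ is the continuous-time Markov chain on $\mathbb{N}_0^n$ in which $q$ jumps to $q+\sum_{i\in B}e_i$ when a request is sent to the set $B$ of servers and to $q-e_i$ at rate $k$ for each $i$ with $q_i>0$. Let $$\pi^n_i(t)=\frac1n\sum_{j=1}^n 1_{\{Q^n_j(t)=i\}},\qquad i\in\mathbb{N}_0,$$ be the empirical measure of the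 queue lengths. It takes values in $\mathcal{S}=\{s\in\mathbb{R}_+^{\mathbb{N}_0}:\sum_{i}s_i=1\}=\mathcal{P}(\mathbb{N}_0)$, which carries the metric $d_0(s,s')=\sum_{j\ge0}2^{-j}|s_j-s'_j|$ (that is, the topology of weak convergence). For $r\in\boldsymbol\ell_1$ and $j\in\mathbb{N}_0$ let (with $0^0=1$ and empty sums equal to $0$) $$\bar\zeta(j,r)=\sum_{i_1=0}^{k-1}\frac{\big(\sum_{m=0}^{j-1}r_m\big)^{i_1}}{i_1!}\sum_{i_2=1}^{L-i_1}\min(i_2,k-i_1)\,\frac{r_j^{i_2}}{i_2!}\,\frac{\big(\sum_{m=j+1}^\infty r_m\big)^{L-i_1-i_2}}{(L-i_1-i_2)!},\qquad \bar\zeta(-1,r)=0,$$ and let $F:\boldsymbol\ell_1\to\boldsymbol\ell_1$ be the map with coordinates $$F_j(r)=\lambda L!\,\big[\bar\zeta(j-1,r)-\bar\zeta(j,r)\big]+k\,[r_{j+1}-r_j]+k\,r_0\,1_{\{j=0\}},\qquad j\in\mathbb{N}_0 .$$ Suppose that $\pi^n(0)\to\pi_0$ in $\mathcal{S}$ as $n\to\infty$.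 Then there is exactly one continuous $\pi:[0,T]\to\mathcal{S}$ that solves $\dot\pi=F(\pi)$, $\pi(0)=\pi_0$, in the sense that $\pi(t)=\pi_0+\int_0^tF(\pi(s))\,ds$ for all $t\in[0,T]$ (a Bochner integral in $\boldsymbol\ell_1$); and $\pi^n\to\pi$ in probability in $\mathbb{D}([0,T]:\mathcal{S})$, the space of right-continuous functions with left limits from $[0,T]$ to $\mathcal{S}$ with the Skorohod ($J_1$) topology. -/

import Mathlib

open MeasureTheory ProbabilityTheory Filter Topology
open scoped ENNReal

noncomputable section

namespace BatchMDS

/-! ### The simplex `𝒮 = 𝒫(ℕ₀)` with the metric `d₀` -/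

/-- The infinite-dimensional simplex, identified with the probability measures on `{0, 1, 2, …}`. -/
def Simplex : Type := {s : ℕ → ℝ // (∀ i, 0 ≤ s i) ∧ HasSum s 1}

namespace Simplex

instance : CoeFun Simplex (fun _ => ℕ → ℝ) := ⟨Subtype.val⟩

theorem nonneg (s : Simplex) (i : ℕ) : 0 ≤ s i := s.2.1 i

theorem hasSum (s : Simplex) : HasSum s 1 := s.2.2

theorem summable_dist (s t : Simplex) : Summable fun j => |s j - t j| / 2 ^ j := by
  refine Summable.of_nonneg_of_le (fun j => by positivity) (fun j => ?_)
    (s.hasSum.summable.add t.hasSum.summable)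
  have h1 : |s j - t j| / 2 ^ j ≤ |s j - t j| :=
    div_le_self (abs_nonneg _) (one_le_pow₀ (by norm_num))
  refine h1.trans (abs_le.2 ⟨?_, ?_⟩) <;> linarith [s.nonneg j, t.nonneg j]

/-- The metric `d₀(s, t) = ∑ⱼ |sⱼ - tⱼ| / 2ʲ`, which metrizes weak convergence. -/
instance : MetricSpace Simplex where
  dist s t := ∑' j, |s j - t j| / 2 ^ j
  dist_self s := by simp
  dist_comm s t := by simp_rw [abs_sub_comm]
  dist_triangle s t u := by
    rw [← (summable_dist s t).tsum_add (summable_dist t u)]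
    refine (summable_dist s u).tsum_le_tsum (fun j => ?_)
      ((summable_dist s t).add (summable_dist t u))
    rw [← add_div]
    gcongr
    exact abs_sub_le _ _ _
  eq_of_dist_eq_zero := by
    intro s t h
    have h0 := (hasSum_zero_iff_of_nonneg (fun j => by positivity)).1
      (h ▸ (summable_dist s t).hasSum)
    refine Subtype.ext (funext fun j => ?_)
    have hj := congrFun h0 j
    have h2 : (2 : ℝ) ^ j ≠ 0 := by positivity
    simp only [Pi.zero_apply, div_eq_zero_iff, h2, or_false, abs_eq_zero] at hj
    linarith

theorem memℓp (s : Simplex) : Memℓp (fun j => s j) 1 := by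
  refine memℓp_gen ?_
  simpa [abs_of_nonneg (s.nonneg _)] using s.hasSum.summable

end Simplex

/-- The Banach space `ℓ₁` of absolutely summable real sequences. -/
abbrev L1 : Type := lp (fun _ : ℕ => ℝ) 1

/-- The inclusion of the simplex into `ℓ₁`. -/
def Simplex.toL1 (s : Simplex) : L1 := ⟨fun j => s j, s.memℓp⟩

/-! ### The drift `F` -/

/-- The quantity `ζ̄(j, r)`. -/
def zetaBar (L k : ℕ) (j : ℕ) (r : ℕ → ℝ) : ℝ :=
  ∑ i₁ ∈ Finset.range k,
    (∑ m ∈ Finset.range j, r m) ^ i₁ / (i₁.factorial : ℝ) *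
      ∑ i₂ ∈ Finset.Icc 1 (L - i₁),
        (min i₂ (k - i₁) : ℕ) * (r j ^ i₂ / (i₂.factorial : ℝ)) *
          ((∑' m, r (j + 1 + m)) ^ (L - i₁ - i₂) / ((L - i₁ - i₂).factorial : ℝ))

/-- `ζ̄(j - 1, r) - ζ̄(j, r)`, where `ζ̄(-1, r) = 0`. -/
def zetaBarDelta (L k : ℕ) (j : ℕ) (r : ℕ → ℝ) : ℝ :=
  (if j = 0 then 0 else zetaBar L k (j - 1) r) - zetaBar L k j r

/-- The `j`-th coordinate of `F(r)`; the last term removes the service rate of the empty queues. -/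
def driftCoord (L k : ℕ) (lam : ℝ) (r : ℕ → ℝ) (j : ℕ) : ℝ :=
  lam * (L.factorial : ℝ) * zetaBarDelta L k j r + k * (r (j + 1) - r j)
    + if j = 0 then k * r 0 else 0

theorem summable_abs_zetaBar (L k : ℕ) (r : ℕ → ℝ) (hr : Summable fun j => |r j|) :
    Summable fun j => |zetaBar L k j r| := by
  have hR : ∀ j, |r j| ≤ ∑' m, |r m| := fun j => hr.le_tsum j (fun _ _ => abs_nonneg _)
  set R := ∑' m, |r m| with hRdef
  have hA : ∀ j, |∑ m ∈ Finset.range j, r m| ≤ R := fun j =>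
    (Finset.abs_sum_le_sum_abs _ _).trans (hr.sum_le_tsum _ (fun _ _ => abs_nonneg _))
  have hB : ∀ j, |∑' m, r (j + 1 + m)| ≤ R := fun j => by
    have hinj : Function.Injective fun m : ℕ => j + 1 + m := fun a b h => by simpa using h
    have hs : Summable fun m => |r (j + 1 + m)| := hr.comp_injective hinj
    refine (norm_tsum_le_tsum_norm (f := fun m => r (j + 1 + m)) hs).trans ?_
    exact Summable.tsum_le_tsum_of_inj _ hinj (fun _ _ => abs_nonneg _) (fun _ => le_rfl) hs hr
  have key : ∀ j, |zetaBar L k j r| ≤ (∑ i₁ ∈ Finset.range k,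
      R ^ i₁ / (i₁.factorial : ℝ) * ∑ i₂ ∈ Finset.Icc 1 (L - i₁),
        (min i₂ (k - i₁) : ℕ) * (R ^ (i₂ - 1) / (i₂.factorial : ℝ)) *
          (R ^ (L - i₁ - i₂) / ((L - i₁ - i₂).factorial : ℝ))) * |r j| := by
    intro j
    have hR0 : 0 ≤ R := (abs_nonneg _).trans (hR 0)
    rw [Finset.sum_mul]
    refine (Finset.abs_sum_le_sum_abs _ _).trans (Finset.sum_le_sum fun i₁ _ => ?_)
    rw [abs_mul, mul_assoc, Finset.sum_mul]
    refine mul_le_mul ?_ ?_ (abs_nonneg _) (by positivity)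
    · rw [abs_div, abs_pow, Nat.abs_cast]
      gcongr
      exact hA j
    · refine (Finset.abs_sum_le_sum_abs _ _).trans (Finset.sum_le_sum fun i₂ hi₂ => ?_)
      obtain ⟨m, rfl⟩ : ∃ m, i₂ = m + 1 := ⟨i₂ - 1, by have := (Finset.mem_Icc.1 hi₂).1; omega⟩
      rw [abs_mul, abs_mul, abs_div, abs_div, abs_pow, abs_pow, Nat.abs_cast, Nat.abs_cast,
        Nat.abs_cast, Nat.add_sub_cancel]
      have h1 : |r j| ^ (m + 1) ≤ R ^ m * |r j| := by
        rw [pow_succ]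
        gcongr
        exact hR j
      have h2 : |∑' m, r (j + 1 + m)| ^ (L - i₁ - (m + 1)) ≤ R ^ (L - i₁ - (m + 1)) := by
        gcongr
        exact hB j
      calc _ ≤ ((min (m + 1) (k - i₁) : ℕ) : ℝ) * (R ^ m * |r j| / ((m + 1).factorial : ℝ)) *
            (R ^ (L - i₁ - (m + 1)) / ((L - i₁ - (m + 1)).factorial : ℝ)) := by gcongr
        _ = _ := by ring
  exact Summable.of_nonneg_of_le (fun _ => abs_nonneg _) key (hr.mul_left _)

theorem memℓp_driftCoord (L k : ℕ) (lam : ℝ) (r : L1) :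
    Memℓp (driftCoord L k lam (fun j => r j)) 1 := by
  have hr : Summable fun j => |r j| := by
    simpa using (lp.memℓp r).summable (by norm_num)
  have hz := summable_abs_zetaBar L k (fun j => r j) hr
  have hz' : Summable fun j : ℕ => if j = 0 then 0 else zetaBar L k (j - 1) (fun j => r j) := by
    rw [← summable_nat_add_iff 1]
    simpa using hz.of_abs
  have h0 : Summable fun j : ℕ => if j = 0 then (k : ℝ) * r 0 else 0 :=
    summable_of_ne_finset_zero (s := {0}) (by simp +contextual)
  have hs : Summable (driftCoord L k lam (fun j => r j)) :=
    (((hz'.sub hz.of_abs).mul_left _).add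
      ((((summable_nat_add_iff 1).2 hr.of_abs).sub hr.of_abs).mul_left _)).add h0
  refine memℓp_gen ?_
  simpa using hs.abs

/-- The map `F : ℓ₁ → ℓ₁`. -/
def drift (L k : ℕ) (lam : ℝ) (r : L1) : L1 :=
  ⟨driftCoord L k lam (fun j => r j), memℓp_driftCoord L k lam r⟩

/-- A continuous path `π : [0,T] → 𝒮` solves `π̇ = F(π)`, `π(0) = π₀` if
`π(t) = π₀ + ∫₀ᵗ F(π(s)) ds` for all `t ∈ [0,T]`, as a Bochner integral in `ℓ₁`. -/
def IsSolution (L k : ℕ) (lam : ℝ) {T : ℝ} (hT : 0 ≤ T) (π₀ : Simplex)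
    (π : C(Set.Icc (0 : ℝ) T, Simplex)) : Prop :=
  ∀ t : Set.Icc (0 : ℝ) T,
    IntervalIntegrable (Set.IccExtend hT fun s => drift L k lam (π s).toL1) volume 0 t ∧
    (π t).toL1 = π₀.toL1 +
      ∫ s in (0 : ℝ)..t, Set.IccExtend hT (fun s => drift L k lam (π s).toL1) s

/-! ### The Skorohod space `𝔻([0,T] : E)` -/

/-- Right continuous functions on `[0,T]` with left limits. -/
structure Cadlag (T : ℝ) (E : Type*) [TopologicalSpace E] where
  toFun : Set.Icc (0 : ℝ) T → E
  rightCts : ∀ t, ContinuousWithinAt toFun (Set.Ici t) t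
  leftLim : ∀ t, ∃ l, Tendsto toFun (𝓝[<] t) (𝓝 l)

instance (T : ℝ) (E : Type*) [TopologicalSpace E] :
    CoeFun (Cadlag T E) (fun _ => Set.Icc (0 : ℝ) T → E) := ⟨Cadlag.toFun⟩

/-- The image of a path under a continuous map of the state space. -/
def Cadlag.map {T : ℝ} {E E' : Type*} [TopologicalSpace E] [TopologicalSpace E']
    (g : E → E') (hg : Continuous g) (x : Cadlag T E) : Cadlag T E' where
  toFun t := g (x t)
  rightCts t := hg.continuousAt.comp_continuousWithinAt (x.rightCts t)
  leftLim t := (x.leftLim t).elim fun l hl => ⟨g l, (hg.tendsto l).comp hl⟩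

/-- A continuous path as an element of the Skorohod space. -/
def Cadlag.ofContinuous {T : ℝ} {E : Type*} [TopologicalSpace E]
    (x : C(Set.Icc (0 : ℝ) T, E)) : Cadlag T E where
  toFun := x
  rightCts _ := x.continuous.continuousWithinAt
  leftLim t := ⟨x t, (x.continuous.tendsto t).mono_left nhdsWithin_le_nhds⟩

/-- The metric of the Skorohod `J₁` topology: the infimum, over the increasing bijections `τ`
of `[0,T]`, of `max (sup_t |τ(t) - t|) (sup_t d(x(τ(t)), y(t)))`. -/
def skorohodEDist {T : ℝ} {E : Type*} [MetricSpace E] (x y : Cadlag T E) : ℝ≥0∞ :=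
  ⨅ τ : Set.Icc (0 : ℝ) T ≃o Set.Icc (0 : ℝ) T,
    max (⨆ t, edist (τ t) t) (⨆ t, edist (x (τ t)) (y t))

/-! ### The `n`-server system -/

/-- Storage of files on `n` servers with `(L, k)` MDS coding: each file is stored at `L` servers,
and each set of `L` servers holds exactly `c` files. -/
structure Storage (n L c : ℕ) where
  numFiles : ℕ
  servers : Fin numFiles → Finset (Fin n)
  card_servers : ∀ i, (servers i).card = L
  card_files : ∀ A : Finset (Fin n), A.card = L →
    (Finset.univ.filter fun i => servers i = A).card = c

/-- `B` consists of `k` servers of `A` with the shortest queues. -/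
def IsShortest {n : ℕ} (k : ℕ) (q : Fin n → ℕ) (A B : Finset (Fin n)) : Prop :=
  B ⊆ A ∧ B.card = k ∧ ∀ i ∈ B, ∀ j ∈ A \ B, q i ≤ q j

/-- A (possibly randomized) choice of the `k` shortest queues in a set of `L` servers:
`prob q A B` is the probability that a request for the set `A` is sent to the servers of `B`, if
the queue lengths are `q`. The freedom is in the way in which ties are broken. -/
structure Routing (n L k : ℕ) where
  prob : (Fin n → ℕ) → Finset (Fin n) → Finset (Fin n) → ℝ
  nonneg : ∀ q A B, 0 ≤ prob q A B
  shortest : ∀ q A B, A.card = L → prob q A B ≠ 0 → IsShortest k q A B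
  sum_eq_one : ∀ q A, A.card = L → ∑ B, prob q A B = 1

/-- One job joins each queue in `B`. -/
def arrive {n : ℕ} (q : Fin n → ℕ) (B : Finset (Fin n)) : Fin n → ℕ :=
  fun j => if j ∈ B then q j + 1 else q j

/-- One job leaves queue `i`. -/
def depart {n : ℕ} (q : Fin n → ℕ) (i : Fin n) : Fin n → ℕ := Function.update q i (q i - 1)

/-- The generator of the queue lengths: requests arrive at rate `n λ`, each for a uniformly chosen
file, and are sent to the `k` shortest queues among the servers of that file; each server with a
non-empty queue completes jobs at rate `k`. -/
def generator {n L c : ℕ} (k : ℕ) (lam : ℝ) (S : Storage n L c) (R : Routing n L k)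
    (f : (Fin n → ℕ) → ℝ) (q : Fin n → ℕ) : ℝ :=
  n * lam * (1 / (S.numFiles : ℝ) * ∑ i, ∑ B,
      R.prob q (S.servers i) B * (f (arrive q B) - f q)) +
    ∑ j, if 0 < q j then (k : ℝ) * (f (depart q j) - f q) else 0

/-- `Q` is the queue length process on `[0,T]` of the `n`-server system started from `q`: the
continuous time Markov chain, with respect to `ℱ`, with this (bounded) generator, given through its
martingale problem. -/
structure IsQueueProcess {n L c : ℕ} (k : ℕ) (lam : ℝ) {T : ℝ} (hT : 0 ≤ T)
    (S : Storage n L c) (R : Routing n L k) {Ω : Type*} [mΩ : MeasurableSpace Ω] (P : Measure Ω)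
    (ℱ : Filtration (Set.Icc (0 : ℝ) T) mΩ) (q : Fin n → ℕ)
    (Q : Ω → Cadlag T (Fin n → ℕ)) : Prop where
  adapted : ∀ t, Measurable[ℱ t] fun ω => Q ω t
  initial : ∀ᵐ ω ∂P, Q ω ⟨0, Set.left_mem_Icc.2 hT⟩ = q
  martingale : ∀ f : (Fin n → ℕ) → ℝ, (∃ C, ∀ x, |f x| ≤ C) →
    Martingale (fun (t : Set.Icc (0 : ℝ) T) ω => f (Q ω t) -
      ∫ s in (0 : ℝ)..t, Set.IccExtend hT (fun s => generator k lam S R f (Q ω s)) s) ℱ P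

/-- The empirical measure of the queue lengths: coordinate `i` is the proportion of the `n` queues
with length `i`. (If there are no queues it is set to the point mass at `0`.) -/
def empirical {n : ℕ} (q : Fin n → ℕ) : Simplex :=
  ⟨fun i => if n = 0 then (if i = 0 then 1 else 0) else
      (1 / (n : ℝ)) * ∑ j, if q j = i then 1 else 0, by
    rcases Nat.eq_zero_or_pos n with hn | hn
    · simp only [hn, if_true]
      exact ⟨fun i => by split_ifs <;> norm_num, hasSum_ite_eq 0 1⟩
    · simp only [hn.ne', if_false]
      refine ⟨fun i => mul_nonneg (by positivity)
        (Finset.sum_nonneg fun j _ => by split_ifs <;> norm_num), ?_⟩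
      have h : HasSum (fun i => ∑ j : Fin n, if q j = i then (1 : ℝ) else 0)
          (∑ _j : Fin n, (1 : ℝ)) := hasSum_sum fun j _ => by
        simpa [eq_comm] using hasSum_ite_eq (q j) (1 : ℝ)
      have h' := h.mul_left (1 / (n : ℝ))
      have hn' : (n : ℝ) ≠ 0 := by positivity
      simpa [hn'] using h'⟩

/-- The empirical measure process, as a path in `𝔻([0,T] : 𝒮)`. -/
def empiricalPath {n : ℕ} {T : ℝ} (x : Cadlag T (Fin n → ℕ)) : Cadlag T Simplex :=
  x.map empirical continuous_of_discreteTopology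

end BatchMDS

end

open BatchMDS

/-!
The sample paths of the empirical measure are, with high probability, approximate integral
solutions of `π̇ = F(π)` for the metric `d₀`. Indeed the generator applied to a coordinate of the
empirical measure differs from that coordinate of `F` only because the `L` queues of a request are
sampled without replacement instead of with replacement, an error of order `1 / n`; and the
remaining martingale is uniformly small by Doob's inequality, since the quadratic variation of a
coordinate grows at a rate of order `1 / n`.

`F` is the net inflow of a flux whose value at level `j` depends on the coordinates up to `j + 1`
only, so that summation by parts against the weights `2⁻ʲ` makes it Lipschitz for `d₀`. By
Gronwall's inequality two approximate solutions stay close, which gives uniqueness and the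
convergence of the empirical measure to any solution. Moreover the sample paths themselves form a
Cauchy sequence of approximate solutions, whose limit is a solution.
-/

noncomputable section

namespace BatchMDS

/-! ### A maximal inequality for right-continuous martingales -/

section MaximalInequality

variable {ι Ω : Type*} {mΩ : MeasurableSpace Ω} {P : Measure Ω} [IsFiniteMeasure P]

theorem submartingale_sq [Preorder ι] {ℱ : Filtration ι mΩ} {M : ι → Ω → ℝ}
    (hM : Martingale M ℱ P) (hM2 : ∀ t, MemLp (M t) 2 P) :
    Submartingale (fun t ω => M t ω ^ 2) ℱ P := by
  refine ⟨fun t => (hM.stronglyAdapted t).pow 2, fun s t hst => ?_, fun t => (hM2 t).integrable_sq⟩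
  have hjensen := (even_two.convexOn_pow (𝕜 := ℝ)).map_condExp_le_univ (ℱ.le s)
    (continuous_pow 2).lowerSemicontinuous (hM.integrable t) (hM2 t).integrable_sq
  filter_upwards [hjensen, hM.condExp_ae_eq hst] with ω h1 h2
  rw [Function.comp_apply, h2] at h1
  exact h1

variable [LinearOrder ι] {ℱ : Filtration ι mΩ} {X : ι → Ω → ℝ}

theorem mul_measure_exists_mem_finset_le (hX : Submartingale X ℱ P) (h0 : 0 ≤ X) (δ : NNReal)
    {b : ι} {F : Finset ι} (hb : IsGreatest (F : Set ι) b) :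
    δ * P {ω | ∃ s ∈ F, δ ≤ X s ω} ≤ ENNReal.ofReal (∫ ω, X b ω ∂P) := by
  obtain ⟨m, hm⟩ : ∃ m, F.card = m + 1 :=
    ⟨F.card - 1, (Nat.succ_pred_eq_of_pos (Finset.card_pos.2 ⟨b, hb.1⟩)).symm⟩
  let e : Fin (m + 1) ↪o ι := F.orderEmbOfFin hm
  let τ : ℕ → ι := fun i => e ⟨min i m, by omega⟩
  have hτ : Monotone τ := fun i j hij => e.monotone (Fin.mk_le_mk.2 (min_le_min_right m hij))
  have hτF : ∀ s, s ∈ F ↔ ∃ i ≤ m, τ i = s := by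
    intro s
    rw [← Finset.mem_coe, ← Finset.range_orderEmbOfFin F hm]
    constructor
    · rintro ⟨i, rfl⟩
      exact ⟨i, by omega, congrArg e (Fin.ext (min_eq_left (by omega)))⟩
    · rintro ⟨i, -, rfl⟩
      exact ⟨_, rfl⟩
  have hτb : τ m = b := by
    obtain ⟨i, hi, hib⟩ := (hτF b).1 hb.1
    exact le_antisymm (hb.2 ((hτF _).2 ⟨m, le_rfl, rfl⟩)) (hib ▸ hτ hi)
  let 𝒢 : Filtration ℕ mΩ := ⟨fun i => ℱ (τ i), fun i j hij => ℱ.mono (hτ hij), fun i => ℱ.le _⟩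
  have hXτ : Submartingale (fun i => X (τ i)) 𝒢 P :=
    ⟨fun i => hX.1 _, fun i j hij => hX.2.1 _ _ (hτ hij), fun i => hX.2.2 _⟩
  have hset : {ω | ∃ s ∈ F, δ ≤ X s ω} = {ω | (δ : ℝ) ≤ (Finset.range (m + 1)).sup'
      Finset.nonempty_range_add_one fun i => X (τ i) ω} := by
    ext ω
    simp [Finset.le_sup'_iff, hτF]
  rw [hset]
  refine (maximal_ineq hXτ (fun i => h0 (τ i)) m).trans (ENNReal.ofReal_le_ofReal ?_)
  rw [hτb]
  exact setIntegral_le_integral (hX.integrable b) (ae_of_all _ (h0 b))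

variable [TopologicalSpace ι] [OrderTopology ι] [DenselyOrdered ι]
  [TopologicalSpace.SeparableSpace ι]

theorem measure_exists_lt_le (hX : Submartingale X ℱ P) (h0 : 0 ≤ X)
    (hrc : ∀ ω t, ContinuousWithinAt (X · ω) (Set.Ici t) t) {b : ι} (hb : IsTop b) {δ : ℝ}
    (hδ : 0 < δ) : P {ω | ∃ t, δ < X t ω} ≤ ENNReal.ofReal ((∫ ω, X b ω ∂P) / δ) := by
  have : Nonempty ι := ⟨b⟩
  let d := TopologicalSpace.denseSeq ι
  let F : ℕ → Finset ι := fun m => insert b ((Finset.range m).image d)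
  have hF : Monotone F := fun m m' h =>
    Finset.insert_subset_insert _ (Finset.image_subset_image (Finset.range_subset_range.2 h))
  let E : ℕ → Set Ω := fun m => {ω | ∃ s ∈ F m, δ ≤ X s ω}
  have hE : Monotone E := fun m m' h ω ⟨s, hs, hsω⟩ => ⟨s, hF h hs, hsω⟩
  have hsub : {ω | ∃ t, δ < X t ω} ⊆ ⋃ m, E m := by
    rintro ω ⟨t, ht⟩
    rw [Set.mem_iUnion]
    rcases (hb t).eq_or_lt with rfl | htb
    · exact ⟨0, t, Finset.mem_insert_self _ _, ht.le⟩
    · have hU : {s | δ < X s ω} ∈ 𝓝[>] t :=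
        nhdsWithin_mono t Set.Ioi_subset_Ici_self ((hrc ω t).eventually_const_lt ht)
      obtain ⟨u, hu, hUu⟩ := (mem_nhdsGT_iff_exists_Ioo_subset' htb).1 hU
      obtain ⟨i, hi⟩ := (TopologicalSpace.denseRange_denseSeq ι).exists_mem_open
        isOpen_Ioo (Set.nonempty_Ioo.2 hu)
      exact ⟨i + 1, d i, Finset.mem_insert_of_mem
        (Finset.mem_image_of_mem d (Finset.self_mem_range_succ i)), (hUu hi).le⟩
  refine (measure_mono hsub).trans ?_
  rw [hE.measure_iUnion]
  refine iSup_le fun m => ?_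
  lift δ to NNReal using hδ.le
  rw [ENNReal.ofReal_div_of_pos hδ, ENNReal.ofReal_coe_nnreal,
    ENNReal.le_div_iff_mul_le (Or.inl (by simpa using hδ.ne')) (by simp), mul_comm]
  exact mul_measure_exists_mem_finset_le hX h0 δ
    ⟨Finset.mem_insert_self _ _, fun s _ => hb s⟩

theorem measure_exists_lt_abs_le {M : ι → Ω → ℝ} (hM : Martingale M ℱ P)
    (hM2 : ∀ t, MemLp (M t) 2 P) (hrc : ∀ ω t, ContinuousWithinAt (M · ω) (Set.Ici t) t)
    {b : ι} (hb : IsTop b) {δ : ℝ} (hδ : 0 < δ) :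
    P {ω | ∃ t, δ < |M t ω|} ≤ ENNReal.ofReal ((∫ ω, M b ω ^ 2 ∂P) / δ ^ 2) := by
  have hset : {ω | ∃ t, δ < |M t ω|} = {ω | ∃ t, δ ^ 2 < M t ω ^ 2} := by
    simp_rw [sq_lt_sq, abs_of_pos hδ]
  rw [hset]
  exact measure_exists_lt_le (submartingale_sq hM hM2) (fun t ω => sq_nonneg _)
    (fun ω t => (hrc ω t).pow 2) hb (pow_pos hδ 2)

end MaximalInequality

/-! ### Time integrals of right-continuous processes -/

theorem measurable_uncurry_of_rightCts {Ω E : Type*} [MeasurableSpace Ω] [TopologicalSpace E]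
    [TopologicalSpace.PseudoMetrizableSpace E] [MeasurableSpace E] [BorelSpace E]
    {X : ℝ → Ω → E} (hX : ∀ t, Measurable (X t))
    (hrc : ∀ ω t, ContinuousWithinAt (X · ω) (Set.Ici t) t) : Measurable (Function.uncurry X) := by
  let ρ : ℕ → ℝ → ℝ := fun m s => (⌊s * (m + 1)⌋ + 1) / (m + 1)
  have hlt (m : ℕ) (s : ℝ) : s < ρ m s := by
    rw [lt_div_iff₀ (by positivity)]
    exact Int.lt_floor_add_one _
  have hle (m : ℕ) (s : ℝ) : ρ m s ≤ s + 1 / (m + 1) := by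
    rw [div_le_iff₀ (by positivity), add_mul, one_div_mul_cancel (by positivity)]
    gcongr
    exact Int.floor_le _
  have hρ (s : ℝ) : Tendsto (ρ · s) atTop (𝓝[≥] s) := by
    refine tendsto_nhdsWithin_iff.2 ⟨?_, Eventually.of_forall fun m => (hlt m s).le⟩
    refine tendsto_of_tendsto_of_tendsto_of_le_of_le tendsto_const_nhds ?_
      (fun m => (hlt m s).le) (hle · s)
    simpa using tendsto_const_nhds.add (tendsto_one_div_add_atTop_nhds_zero_nat (𝕜 := ℝ))
  refine measurable_of_tendsto_metrizable (f := fun m (p : ℝ × Ω) => X (ρ m p.1) p.2)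
    (fun m => ?_) (tendsto_pi_nhds.2 fun p => (hrc p.2 p.1).tendsto.comp (hρ p.1))
  have hgrid : Measurable fun p : ℤ × Ω => X ((p.1 + 1) / (m + 1)) p.2 :=
    measurable_from_prod_countable_right fun i => hX ((i + 1) / (m + 1))
  have hfloor : Measurable fun p : ℝ × Ω => (⌊p.1 * (m + 1)⌋, p.2) := by fun_prop
  exact hgrid.comp hfloor

section TimeIntegral

variable {T : ℝ} (hT : 0 ≤ T)

/-- The integral `∫₀ᵗ x(s) ds` of a path on `[0,T]`. -/
def timeIntegral {E : Type*} [NormedAddCommGroup E] [NormedSpace ℝ E]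
    (x : Set.Icc (0 : ℝ) T → E) (t : Set.Icc (0 : ℝ) T) : E :=
  ∫ s in (0 : ℝ)..t, Set.IccExtend hT x s

theorem rightCts_IccExtend {E : Type*} [TopologicalSpace E] {x : Set.Icc (0 : ℝ) T → E}
    (hx : ∀ t, ContinuousWithinAt x (Set.Ici t) t) (t : ℝ) :
    ContinuousWithinAt (Set.IccExtend hT x) (Set.Ici t) t :=
  (hx (Set.projIcc 0 T hT t)).comp continuous_projIcc.continuousWithinAt
    fun _ hs => Set.monotone_projIcc hT hs

theorem measurable_IccExtend {E : Type*} [TopologicalSpace E]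
    [TopologicalSpace.PseudoMetrizableSpace E] [MeasurableSpace E] [BorelSpace E]
    {x : Set.Icc (0 : ℝ) T → E} (hx : ∀ t, ContinuousWithinAt x (Set.Ici t) t) :
    Measurable (Set.IccExtend hT x) :=
  (measurable_uncurry_of_rightCts (X := fun t (_ : Unit) => Set.IccExtend hT x t)
    (fun _ => measurable_const) fun _ => rightCts_IccExtend hT hx).comp
    (measurable_prodMk_right (y := ()))

theorem intervalIntegrable_IccExtend {x : Set.Icc (0 : ℝ) T → ℝ}
    (hx : ∀ t, ContinuousWithinAt x (Set.Ici t) t) {C : ℝ} (hC : ∀ t, |x t| ≤ C) (a b : ℝ) :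
    IntervalIntegrable (Set.IccExtend hT x) volume a b :=
  (intervalIntegrable_const (c := C)).mono_fun (measurable_IccExtend hT hx).aestronglyMeasurable
    (ae_of_all _ fun _ => (hC _).trans (le_abs_self C))

theorem continuous_timeIntegral {x : Set.Icc (0 : ℝ) T → ℝ}
    (hx : ∀ a b, IntervalIntegrable (Set.IccExtend hT x) volume a b) :
    Continuous (timeIntegral hT x) :=
  (intervalIntegral.continuous_primitive hx 0).comp continuous_subtype_val

theorem norm_timeIntegral_le {E : Type*} [NormedAddCommGroup E] [NormedSpace ℝ E]
    {x : Set.Icc (0 : ℝ) T → E} {C : ℝ} (hC : ∀ t, ‖x t‖ ≤ C) (t : Set.Icc (0 : ℝ) T) :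
    ‖timeIntegral hT x t‖ ≤ C * t := by
  have h := intervalIntegral.norm_integral_le_of_norm_le_const (a := 0) (b := t)
    (f := Set.IccExtend hT x) fun s _ => hC (Set.projIcc 0 T hT s)
  rwa [sub_zero, abs_of_nonneg t.2.1] at h

theorem two_mul_integral_primitive_mul {g : ℝ → ℝ} {a b : ℝ}
    (hg : IntervalIntegrable g volume a b) :
    2 * ∫ s in a..b, (∫ u in a..s, g u) * g s = (∫ s in a..b, g s) ^ 2 := by
  let G : ℝ → ℝ := fun s => ∫ u in a..s, g u
  have hG : AbsolutelyContinuousOnInterval G a b :=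
    hg.absolutelyContinuousOnInterval_intervalIntegral Set.left_mem_uIcc
  have hderiv : ∀ᵐ s, s ∈ Set.uIoc a b → deriv G s * G s + G s * deriv G s = 2 * (G s * g s) := by
    filter_upwards [hg.ae_hasDerivAt_integral] with s hs hsab
    rw [(hs (Set.uIoc_subset_uIcc hsab) a Set.left_mem_uIcc).deriv]
    ring
  rw [← intervalIntegral.integral_const_mul, ← intervalIntegral.integral_congr_ae hderiv,
    hG.integral_deriv_mul_eq_sub hG]
  simp [G, sq]

end TimeIntegral

/-! ### The second moment of a compensated process -/

theorem integral_mul_martingale {ι Ω : Type*} [Preorder ι] {mΩ : MeasurableSpace Ω}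
    {P : Measure Ω} [IsFiniteMeasure P] {ℱ : Filtration ι mΩ} {M : ι → Ω → ℝ}
    (hM : Martingale M ℱ P) {s t : ι} (hst : s ≤ t) {Z : Ω → ℝ} (hZ : Measurable[ℱ s] Z)
    {C : ℝ} (hC : ∀ ω, |Z ω| ≤ C) :
    ∫ ω, Z ω * M t ω ∂P = ∫ ω, Z ω * M s ω ∂P := by
  have hint : Integrable (Z * M t) P :=
    (hM.integrable t).bdd_mul (hZ.mono (ℱ.le s) le_rfl).aestronglyMeasurable
      (ae_of_all _ hC)
  calc ∫ ω, Z ω * M t ω ∂P = ∫ ω, (P[Z * M t | ℱ s]) ω ∂P := (integral_condExp (ℱ.le s)).symm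
    _ = ∫ ω, Z ω * M s ω ∂P := integral_congr_ae <| by
      filter_upwards [condExp_mul_of_stronglyMeasurable_left hZ.stronglyMeasurable hint
        (hM.integrable t), hM.2 s t hst] with ω hpull hcond
      rw [hpull, Pi.mul_apply, hcond]

section CompensatedProcess

variable {T : ℝ} {hT : 0 ≤ T} {Ω : Type*} {mΩ : MeasurableSpace Ω} {P : Measure Ω}
  {ℱ : Filtration (Set.Icc (0 : ℝ) T) mΩ}
  {X Y f g h : Set.Icc (0 : ℝ) T → Ω → ℝ}

/-- `X` is a uniformly bounded `ℱ`-adapted process on `[0,T]` with right-continuous paths. Under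
these conditions all the integrals below exist. -/
structure IsBddRightCts (ℱ : Filtration (Set.Icc (0 : ℝ) T) mΩ)
    (X : Set.Icc (0 : ℝ) T → Ω → ℝ) : Prop where
  measurable : ∀ t, Measurable[ℱ t] (X t)
  rightCts : ∀ ω t, ContinuousWithinAt (X · ω) (Set.Ici t) t
  bounded : ∃ C, ∀ t ω, |X t ω| ≤ C

namespace IsBddRightCts

theorem const (c : ℝ) : IsBddRightCts ℱ fun _ _ => c where
  measurable _ := measurable_const
  rightCts _ _ := continuousWithinAt_const
  bounded := ⟨|c|, fun _ _ => le_rfl⟩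

theorem sub (hX : IsBddRightCts ℱ X) (hY : IsBddRightCts ℱ Y) :
    IsBddRightCts ℱ fun t ω => X t ω - Y t ω where
  measurable t := (hX.measurable t).sub (hY.measurable t)
  rightCts ω t := (hX.rightCts ω t).sub (hY.rightCts ω t)
  bounded := by
    obtain ⟨C, hC⟩ := hX.bounded
    obtain ⟨D, hD⟩ := hY.bounded
    exact ⟨C + D, fun t ω => (abs_sub _ _).trans (add_le_add (hC t ω) (hD t ω))⟩

theorem mul (hX : IsBddRightCts ℱ X) (hY : IsBddRightCts ℱ Y) :
    IsBddRightCts ℱ fun t ω => X t ω * Y t ω where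
  measurable t := (hX.measurable t).mul (hY.measurable t)
  rightCts ω t := (hX.rightCts ω t).mul (hY.rightCts ω t)
  bounded := by
    obtain ⟨C, hC⟩ := hX.bounded
    obtain ⟨D, hD⟩ := hY.bounded
    refine ⟨C * D, fun t ω => (abs_mul _ _).trans_le ?_⟩
    exact mul_le_mul (hC t ω) (hD t ω) (abs_nonneg _) ((abs_nonneg _).trans (hC t ω))

theorem intervalIntegrable (hX : IsBddRightCts ℱ X) (ω : Ω) (a b : ℝ) :
    IntervalIntegrable (Set.IccExtend hT (X · ω)) volume a b := by
  obtain ⟨C, hC⟩ := hX.bounded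
  exact intervalIntegrable_IccExtend hT (hX.rightCts ω) (hC · ω) a b

theorem measurable_uncurry (hX : IsBddRightCts ℱ X) :
    Measurable fun p : ℝ × Ω => X (Set.projIcc 0 T hT p.1) p.2 :=
  measurable_uncurry_of_rightCts (X := fun s => X (Set.projIcc 0 T hT s))
    (fun _ => (hX.measurable _).mono (ℱ.le _) le_rfl)
    fun ω => rightCts_IccExtend hT (hX.rightCts ω)

theorem compensated (hf : IsBddRightCts ℱ f) (hg : IsBddRightCts ℱ g)
    (hM : Martingale (fun t ω => f t ω - timeIntegral hT (g · ω) t) ℱ P) :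
    IsBddRightCts ℱ fun t ω => f t ω - timeIntegral hT (g · ω) t where
  measurable t := (hM.1 t).measurable
  rightCts ω t := (hf.rightCts ω t).sub
    (continuous_timeIntegral hT (hg.intervalIntegrable ω)).continuousWithinAt
  bounded := by
    obtain ⟨C, hC⟩ := hf.bounded
    obtain ⟨D, hD⟩ := hg.bounded
    refine ⟨C + D * T, fun t ω => (abs_sub _ _).trans (add_le_add (hC t ω) ?_)⟩
    have hD0 : 0 ≤ D := (abs_nonneg _).trans (hD t ω)
    exact (norm_timeIntegral_le hT (x := (g · ω)) (hD · ω) t).trans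
      (mul_le_mul_of_nonneg_left t.2.2 hD0)

variable [IsProbabilityMeasure P]

theorem integrable (hX : IsBddRightCts ℱ X) (t : Set.Icc (0 : ℝ) T) : Integrable (X t) P := by
  obtain ⟨C, hC⟩ := hX.bounded
  exact .of_bound ((hX.measurable t).mono (ℱ.le t) le_rfl).aestronglyMeasurable C
    (ae_of_all _ (hC t))

theorem integral_timeIntegral {φ : Set.Icc (0 : ℝ) T → Ω → ℝ}
    (hφ : Measurable fun p : ℝ × Ω => φ (Set.projIcc 0 T hT p.1) p.2) {C : ℝ}
    (hC : ∀ t ω, |φ t ω| ≤ C) (t : Set.Icc (0 : ℝ) T) :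
    ∫ ω, timeIntegral hT (φ · ω) t ∂P = timeIntegral hT (fun s => ∫ ω, φ s ω ∂P) t := by
  refine (intervalIntegral_integral_swap ?_).symm
  rw [Set.uIoc_of_le t.2.1]
  exact .of_bound hφ.aestronglyMeasurable C (ae_of_all _ fun p => hC _ p.2)

theorem integrable_timeIntegral (hX : IsBddRightCts ℱ X) (t : Set.Icc (0 : ℝ) T) :
    Integrable (fun ω => timeIntegral hT (X · ω) t) P := by
  obtain ⟨C, hC⟩ := hX.bounded
  have hmeas : StronglyMeasurable fun ω => timeIntegral hT (X · ω) t := by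
    simp only [timeIntegral, intervalIntegral.integral_of_le t.2.1]
    exact (hX.measurable_uncurry (hT := hT)).stronglyMeasurable.integral_prod_left
  exact .of_bound hmeas.aestronglyMeasurable (C * t)
    (ae_of_all _ fun ω => norm_timeIntegral_le hT (hC · ω) t)

end IsBddRightCts

theorem sq_sub_timeIntegral (hf : IsBddRightCts ℱ f) (hg : IsBddRightCts ℱ g) (ω : Ω)
    (t : Set.Icc (0 : ℝ) T) :
    (f t ω - timeIntegral hT (g · ω) t) ^ 2 =
      f t ω ^ 2 - 2 * timeIntegral hT (fun s => f s ω * g s ω) t +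
        2 * (timeIntegral hT (fun s => g s ω * (f s ω - timeIntegral hT (g · ω) s)) t -
          timeIntegral hT (g · ω) t * (f t ω - timeIntegral hT (g · ω) t)) := by
  let A : ℝ → ℝ := fun s => ∫ u in (0 : ℝ)..s, Set.IccExtend hT (g · ω) u
  have hg' := hg.intervalIntegrable (hT := hT) ω
  have hsplit : timeIntegral hT (fun s => g s ω * (f s ω - timeIntegral hT (g · ω) s)) t =
      timeIntegral hT (fun s => f s ω * g s ω) t -
        ∫ s in (0 : ℝ)..t, A s * Set.IccExtend hT (g · ω) s := by
    refine Eq.trans ?_ (intervalIntegral.integral_sub ((hf.mul hg).intervalIntegrable ω 0 t)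
      ((hg' 0 t).continuousOn_mul (intervalIntegral.continuous_primitive hg' 0).continuousOn))
    refine intervalIntegral.integral_congr fun s hs => ?_
    rw [Set.uIcc_of_le t.2.1] at hs
    have hsT : s ∈ Set.Icc 0 T := ⟨hs.1, hs.2.trans t.2.2⟩
    simp only [Set.IccExtend, Function.comp_apply, Set.projIcc_of_mem hT hsT, timeIntegral, A]
    ring
  have hsq := two_mul_integral_primitive_mul (hg' 0 t)
  rw [hsplit]
  simp only [timeIntegral, A] at hsq ⊢
  linear_combination hsq

theorem sq_compensated_eq (hf : IsBddRightCts ℱ f) (hg : IsBddRightCts ℱ g)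
    (hh : IsBddRightCts ℱ h) (ω : Ω) (t : Set.Icc (0 : ℝ) T) :
    (f t ω - timeIntegral hT (g · ω) t) ^ 2 = f t ω ^ 2 - timeIntegral hT (h · ω) t +
      timeIntegral hT (fun s => h s ω - 2 * f s ω * g s ω) t +
        2 * (timeIntegral hT (fun s => g s ω * (f s ω - timeIntegral hT (g · ω) s)) t -
          timeIntegral hT (g · ω) t * (f t ω - timeIntegral hT (g · ω) t)) := by
  have hlin : timeIntegral hT (fun s => h s ω - 2 * f s ω * g s ω) t =
      timeIntegral hT (h · ω) t - 2 * timeIntegral hT (fun s => f s ω * g s ω) t := by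
    simp only [timeIntegral, ← intervalIntegral.integral_const_mul]
    refine Eq.trans ?_ (intervalIntegral.integral_sub (hh.intervalIntegrable ω 0 t)
      (((hf.mul hg).intervalIntegrable ω 0 t).const_mul 2))
    exact intervalIntegral.integral_congr fun s _ => by
      simp only [Set.IccExtend, Function.comp_apply, mul_assoc]
  rw [sq_sub_timeIntegral hf hg, hlin]
  ring

variable [IsProbabilityMeasure P]

theorem integral_timeIntegral_mul_martingale {M : Set.Icc (0 : ℝ) T → Ω → ℝ}
    (hM : Martingale M ℱ P) (hMb : IsBddRightCts ℱ M) (hg : IsBddRightCts ℱ g)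
    (t : Set.Icc (0 : ℝ) T) :
    ∫ ω, timeIntegral hT (g · ω) t * M t ω ∂P =
      ∫ ω, timeIntegral hT (fun s => g s ω * M s ω) t ∂P := by
  obtain ⟨C, hC⟩ := hg.bounded
  obtain ⟨D, hD⟩ := hMb.bounded
  have hbound (s r : Set.Icc (0 : ℝ) T) (ω : Ω) : |g s ω * M r ω| ≤ C * D :=
    (abs_mul _ _).trans_le
      (mul_le_mul (hC s ω) (hD r ω) (abs_nonneg _) ((abs_nonneg _).trans (hC s ω)))
  have hmeas : Measurable fun p : ℝ × Ω => g (Set.projIcc 0 T hT p.1) p.2 * M t p.2 :=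
    hg.measurable_uncurry.mul (((hMb.measurable t).mono (ℱ.le t) le_rfl).comp measurable_snd)
  calc ∫ ω, timeIntegral hT (g · ω) t * M t ω ∂P
      = ∫ ω, timeIntegral hT (fun s => g s ω * M t ω) t ∂P := by
        simp only [timeIntegral, ← intervalIntegral.integral_mul_const]; rfl
    _ = timeIntegral hT (fun s => ∫ ω, g s ω * M t ω ∂P) t :=
        IsBddRightCts.integral_timeIntegral hmeas (hbound · t) t
    _ = timeIntegral hT (fun s => ∫ ω, g s ω * M s ω ∂P) t := by
        refine intervalIntegral.integral_congr fun s hs => ?_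
        rw [Set.uIcc_of_le t.2.1] at hs
        have hst : Set.projIcc 0 T hT s ≤ t :=
          (Set.monotone_projIcc hT hs.2).trans_eq (Set.projIcc_val hT t)
        exact integral_mul_martingale hM hst (hg.measurable _) (hC _)
    _ = ∫ ω, timeIntegral hT (fun s => g s ω * M s ω) t ∂P :=
        (IsBddRightCts.integral_timeIntegral (hg.mul hMb).measurable_uncurry
          (fun s => hbound s s) t).symm

theorem integral_sq_compensated (hf : IsBddRightCts ℱ f) (hg : IsBddRightCts ℱ g)
    (hh : IsBddRightCts ℱ h)
    (hM : Martingale (fun t ω => f t ω - timeIntegral hT (g · ω) t) ℱ P)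
    (hN : Martingale (fun t ω => f t ω ^ 2 - timeIntegral hT (h · ω) t) ℱ P)
    (t : Set.Icc (0 : ℝ) T) :
    ∫ ω, (f t ω - timeIntegral hT (g · ω) t) ^ 2 ∂P =
      ∫ ω, f ⟨0, Set.left_mem_Icc.2 hT⟩ ω ^ 2 ∂P +
        ∫ ω, timeIntegral hT (fun s => h s ω - 2 * f s ω * g s ω) t ∂P := by
  let M : Set.Icc (0 : ℝ) T → Ω → ℝ := fun t ω => f t ω - timeIntegral hT (g · ω) t
  let N : Set.Icc (0 : ℝ) T → Ω → ℝ := fun t ω => f t ω ^ 2 - timeIntegral hT (h · ω) t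
  let W : Set.Icc (0 : ℝ) T → Ω → ℝ := fun t ω => h t ω - 2 * f t ω * g t ω
  have hMb : IsBddRightCts ℱ M := hf.compensated hg hM
  have hWb : IsBddRightCts ℱ W := hh.sub (((IsBddRightCts.const 2).mul hf).mul hg)
  have hNt : ∫ ω, N t ω ∂P = ∫ ω, f ⟨0, Set.left_mem_Icc.2 hT⟩ ω ^ 2 ∂P := by
    have h0 : (⟨0, Set.left_mem_Icc.2 hT⟩ : Set.Icc (0 : ℝ) T) ≤ t := t.2.1
    simpa [timeIntegral, N] using (hN.setIntegral_eq h0 (s := Set.univ) MeasurableSet.univ).symm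
  have hAM : Integrable (fun ω => timeIntegral hT (g · ω) t * M t ω) P :=
    (((hf.sub hMb).mul hMb).integrable t).congr (ae_of_all _ fun ω => by simp [M])
  have hgM : Integrable (fun ω => timeIntegral hT (fun s => g s ω * M s ω) t) P :=
    (hg.mul hMb).integrable_timeIntegral t
  let R : Ω → ℝ := fun ω =>
    timeIntegral hT (fun s => g s ω * M s ω) t - timeIntegral hT (g · ω) t * M t ω
  have hR : ∫ ω, R ω ∂P = 0 := by
    rw [integral_sub hgM hAM, integral_timeIntegral_mul_martingale hM hMb hg, sub_self]
  have hWt : Integrable (fun ω => timeIntegral hT (W · ω) t) P := hWb.integrable_timeIntegral t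
  calc ∫ ω, M t ω ^ 2 ∂P
      = ∫ ω, (N t ω + timeIntegral hT (W · ω) t + 2 * R ω) ∂P :=
        integral_congr_ae (ae_of_all _ fun ω => sq_compensated_eq hf hg hh ω t)
    _ = ∫ ω, N t ω ∂P + ∫ ω, timeIntegral hT (W · ω) t ∂P := by
        have hNW : Integrable (fun ω => N t ω + timeIntegral hT (W · ω) t) P :=
          (hN.integrable t).add hWt
        have hRi : Integrable R P := hgM.sub hAM
        rw [integral_add hNW (hRi.const_mul 2), integral_const_mul, hR, mul_zero, add_zero]
        exact integral_add (hN.integrable t) hWt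
    _ = _ := by rw [hNt]

theorem integral_sq_compensated_sub_initial (hf : IsBddRightCts ℱ f) (hg : IsBddRightCts ℱ g)
    (hh : IsBddRightCts ℱ h)
    (hM : Martingale (fun t ω => f t ω - timeIntegral hT (g · ω) t) ℱ P)
    (hN : Martingale (fun t ω => f t ω ^ 2 - timeIntegral hT (h · ω) t) ℱ P)
    (t : Set.Icc (0 : ℝ) T) :
    ∫ ω, (f t ω - timeIntegral hT (g · ω) t - f ⟨0, Set.left_mem_Icc.2 hT⟩ ω) ^ 2 ∂P =
      ∫ ω, timeIntegral hT (fun s => h s ω - 2 * f s ω * g s ω) t ∂P := by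
  let z : Set.Icc (0 : ℝ) T := ⟨0, Set.left_mem_Icc.2 hT⟩
  let M : Set.Icc (0 : ℝ) T → Ω → ℝ := fun t ω => f t ω - timeIntegral hT (g · ω) t
  have hMb : IsBddRightCts ℱ M := hf.compensated hg hM
  obtain ⟨C, hC⟩ := hf.bounded
  have horth : ∫ ω, f z ω * M t ω ∂P = ∫ ω, f z ω ^ 2 ∂P := by
    simpa [M, timeIntegral, z, sq] using
      integral_mul_martingale hM (show z ≤ t from t.2.1) (hf.measurable z) (hC z)
  have hMt : Integrable (fun ω => M t ω ^ 2) P := by simpa [sq] using (hMb.mul hMb).integrable t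
  have hfz : Integrable (fun ω => f z ω ^ 2) P := by simpa [sq] using (hf.mul hf).integrable z
  have hfM : Integrable (fun ω => f z ω * M t ω) P :=
    (hMb.integrable t).bdd_mul ((hf.integrable z).aestronglyMeasurable) (ae_of_all _ (hC z))
  calc ∫ ω, (M t ω - f z ω) ^ 2 ∂P
      = ∫ ω, (M t ω ^ 2 - 2 * (f z ω * M t ω) + f z ω ^ 2) ∂P :=
        integral_congr_ae (ae_of_all _ fun ω => by ring)
    _ = ∫ ω, M t ω ^ 2 ∂P - ∫ ω, f z ω ^ 2 ∂P := by
        have hsub : Integrable (fun ω => M t ω ^ 2 - 2 * (f z ω * M t ω)) P :=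
          hMt.sub (hfM.const_mul 2)
        rw [integral_add hsub hfz, integral_sub hMt (hfM.const_mul 2), integral_const_mul, horth]
        ring
    _ = ∫ ω, timeIntegral hT (fun s => h s ω - 2 * f s ω * g s ω) t ∂P := by
        rw [integral_sq_compensated hf hg hh hM hN, add_sub_cancel_left]

theorem measure_exists_lt_abs_compensated_sub_le (hf : IsBddRightCts ℱ f)
    (hg : IsBddRightCts ℱ g) (hh : IsBddRightCts ℱ h)
    (hM : Martingale (fun t ω => f t ω - timeIntegral hT (g · ω) t) ℱ P)
    (hN : Martingale (fun t ω => f t ω ^ 2 - timeIntegral hT (h · ω) t) ℱ P)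
    {γ : ℝ} (hγ : ∀ t ω, h t ω - 2 * f t ω * g t ω ≤ γ)
    {x₀ : ℝ} (h0 : ∀ᵐ ω ∂P, f ⟨0, Set.left_mem_Icc.2 hT⟩ ω = x₀) {δ : ℝ} (hδ : 0 < δ) :
    P {ω | ∃ t, δ < |f t ω - timeIntegral hT (g · ω) t - x₀|} ≤
      ENNReal.ofReal (γ * T / δ ^ 2) := by
  have hXb : IsBddRightCts ℱ fun t ω => f t ω - timeIntegral hT (g · ω) t - x₀ :=
    (hf.compensated hg hM).sub (IsBddRightCts.const x₀)
  have hWb : IsBddRightCts ℱ fun t ω => h t ω - 2 * f t ω * g t ω :=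
    hh.sub (((IsBddRightCts.const 2).mul hf).mul hg)
  have hL2 (t : Set.Icc (0 : ℝ) T) :
      MemLp (fun ω => f t ω - timeIntegral hT (g · ω) t - x₀) 2 P := by
    obtain ⟨C, hC⟩ := hXb.bounded
    exact .of_bound (hXb.integrable t).aestronglyMeasurable C (ae_of_all _ (hC t))
  let e : Set.Icc (0 : ℝ) T := ⟨T, Set.right_mem_Icc.2 hT⟩
  refine (measure_exists_lt_abs_le (hM.sub (martingale_const ℱ P x₀)) hL2 hXb.rightCts
    (b := e) (fun t => t.2.2) hδ).trans (ENNReal.ofReal_le_ofReal ?_)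
  gcongr
  calc ∫ ω, (f e ω - timeIntegral hT (g · ω) e - x₀) ^ 2 ∂P
      = ∫ ω, (f e ω - timeIntegral hT (g · ω) e - f ⟨0, Set.left_mem_Icc.2 hT⟩ ω) ^ 2 ∂P := by
        refine integral_congr_ae ?_
        filter_upwards [h0] with ω hω
        rw [hω]
    _ = ∫ ω, timeIntegral hT (fun s => h s ω - 2 * f s ω * g s ω) e ∂P :=
        integral_sq_compensated_sub_initial hf hg hh hM hN e
    _ ≤ ∫ _, γ * T ∂P := by
        refine integral_mono (hWb.integrable_timeIntegral e) (integrable_const _) fun ω => ?_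
        refine (intervalIntegral.integral_mono hT (hWb.intervalIntegrable ω 0 T)
          intervalIntegrable_const fun s => hγ _ ω).trans_eq ?_
        rw [intervalIntegral.integral_const, sub_zero, smul_eq_mul, mul_comm]
    _ = γ * T := by simp

end CompensatedProcess

/-! ### The generator of the empirical measure -/

/-- The rate of change of the mass at each level, if `Φ j` is the net flux of mass from level `j`
to level `j + 1`. -/
def netInflow (Φ : ℕ → ℝ) : ℕ → ℝ
  | 0 => -Φ 0
  | j + 1 => Φ j - Φ (j + 1)

theorem netInflow_sub (Φ Ψ : ℕ → ℝ) (j : ℕ) :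
    netInflow (fun i => Φ i - Ψ i) j = netInflow Φ j - netInflow Ψ j := by
  cases j <;> simp only [netInflow] <;> ring

theorem netInflow_const_mul (a : ℝ) (Φ : ℕ → ℝ) (j : ℕ) :
    netInflow (fun i => a * Φ i) j = a * netInflow Φ j := by
  cases j <;> simp only [netInflow] <;> ring

theorem netInflow_sum {ι : Type*} (s : Finset ι) (Φ : ι → ℕ → ℝ) (j : ℕ) :
    netInflow (fun i => ∑ a ∈ s, Φ a i) j = ∑ a ∈ s, netInflow (Φ a) j := by
  cases j <;> simp [netInflow]

theorem sum_range_succ_netInflow (Φ : ℕ → ℝ) (J : ℕ) :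
    ∑ j ∈ Finset.range (J + 1), netInflow Φ j = -Φ J := by
  induction J with
  | zero => simp [netInflow]
  | succ J ih => rw [Finset.sum_range_succ, ih, netInflow]; ring

theorem abs_netInflow_le {Φ : ℕ → ℝ} {b : ℝ} (hΦ : ∀ j, |Φ j| ≤ b) (j : ℕ) :
    |netInflow Φ j| ≤ 2 * b := by
  cases j with
  | zero =>
    rw [netInflow, abs_neg]
    linarith [hΦ 0, abs_nonneg (Φ 0)]
  | succ j => exact (abs_sub _ _).trans (by linarith [hΦ j, hΦ (j + 1)])

theorem sum_range_abs_netInflow_mul_le (Φ : ℕ → ℝ) {w : ℕ → ℝ} (hw : ∀ j, 0 ≤ w j)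
    (hw' : Antitone w) (J : ℕ) :
    ∑ j ∈ Finset.range J, |netInflow Φ j| * w j ≤ 2 * ∑ j ∈ Finset.range J, |Φ j| * w j := by
  have h : ∀ J, ∑ j ∈ Finset.range (J + 1), |netInflow Φ j| * w j ≤
      2 * (∑ j ∈ Finset.range J, |Φ j| * w j) + |Φ J| * w J := by
    intro J
    induction J with
    | zero => simp [netInflow]
    | succ J ih =>
      rw [Finset.sum_range_succ, Finset.sum_range_succ (fun j => |Φ j| * w j)]
      have h1 : |netInflow Φ (J + 1)| * w (J + 1) ≤ |Φ J| * w J + |Φ (J + 1)| * w (J + 1) := by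
        calc _ ≤ (|Φ J| + |Φ (J + 1)|) * w (J + 1) := by
              gcongr
              · exact hw _
              · exact abs_sub _ _
          _ ≤ _ := by
              rw [add_mul]
              gcongr
              exact hw' J.le_succ
      linarith
  cases J with
  | zero => simp
  | succ J =>
    rw [Finset.sum_range_succ (fun j => |Φ j| * w j)]
    linarith [h J, mul_nonneg (abs_nonneg (Φ J)) (hw J)]

theorem Storage.sum_servers {n L c : ℕ} (S : Storage n L c) (g : Finset (Fin n) → ℝ) :
    ∑ i, g (S.servers i) = c * ∑ A ∈ Finset.powersetCard L Finset.univ, g A := by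
  rw [← Finset.sum_fiberwise_of_maps_to (s := Finset.univ) (g := S.servers)
    (t := Finset.powersetCard L Finset.univ)
    (fun i _ => Finset.mem_powersetCard.2 ⟨Finset.subset_univ _, S.card_servers i⟩), Finset.mul_sum]
  refine Finset.sum_congr rfl fun A hA => ?_
  rw [Finset.sum_congr rfl (g := fun _ => g A) fun i hi => by rw [(Finset.mem_filter.1 hi).2],
    Finset.sum_const, S.card_files A (Finset.mem_powersetCard.1 hA).2, nsmul_eq_mul]

theorem Storage.numFiles_eq {n L c : ℕ} (S : Storage n L c) :
    (S.numFiles : ℝ) = c * n.choose L := by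
  simpa using S.sum_servers fun _ => 1

theorem Storage.average_servers {n L c : ℕ} (hc : 1 ≤ c) (S : Storage n L c)
    (g : Finset (Fin n) → ℝ) :
    1 / (S.numFiles : ℝ) * ∑ i, g (S.servers i) =
      (∑ A ∈ Finset.powersetCard L Finset.univ, g A) / n.choose L := by
  rw [S.sum_servers, S.numFiles_eq]
  have : (c : ℝ) ≠ 0 := by positivity
  field_simp

/-- The number of jobs that a request for the servers of `A` sends to queues of length `j`: the
queues shorter than `j` are served first. -/
def routed {n : ℕ} (k : ℕ) (q : Fin n → ℕ) (j : ℕ) (A : Finset (Fin n)) : ℕ :=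
  min (A.filter fun i => q i = j).card (k - (A.filter fun i => q i < j).card)

theorem IsShortest.card_filter_lt {n k : ℕ} {q : Fin n → ℕ} {A B : Finset (Fin n)}
    (h : IsShortest k q A B) (j : ℕ) :
    (B.filter fun i => q i < j).card = min k (A.filter fun i => q i < j).card := by
  obtain ⟨hBA, hcard, hmin⟩ := h
  have hle := Finset.card_le_card (Finset.filter_subset_filter (fun i => q i < j) hBA)
  have hle' := Finset.card_filter_le B (fun i => q i < j)
  by_cases hex : ∃ a ∈ A \ B, q a < j
  · obtain ⟨a, ha, haj⟩ := hex
    have hB : B.filter (fun i => q i < j) = B :=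
      Finset.filter_true_of_mem fun i hi => (hmin i hi a ha).trans_lt haj
    rw [hB] at hle ⊢
    omega
  · push Not at hex
    have hAB : A.filter (fun i => q i < j) = B.filter fun i => q i < j := by
      ext i
      have := hex i
      have := @hBA i
      simp only [Finset.mem_filter, Finset.mem_sdiff] at *
      grind
    rw [hAB]
    omega

theorem card_filter_lt_succ {α : Type*} (q : α → ℕ) (A : Finset α) (j : ℕ) :
    (A.filter fun i => q i < j + 1).card =
      (A.filter fun i => q i < j).card + (A.filter fun i => q i = j).card := by
  classical
  rw [← Finset.card_union_of_disjoint (Finset.disjoint_filter.2 fun _ _ h => h.ne),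
    ← Finset.filter_or]
  simp only [Nat.lt_succ_iff_lt_or_eq]

theorem IsShortest.card_filter_eq {n k : ℕ} {q : Fin n → ℕ} {A B : Finset (Fin n)}
    (h : IsShortest k q A B) (j : ℕ) : (B.filter fun i => q i = j).card = routed k q j A := by
  have h1 := h.card_filter_lt j
  have h2 := h.card_filter_lt (j + 1)
  rw [card_filter_lt_succ, card_filter_lt_succ] at h2
  unfold routed
  omega

theorem empirical_eq_card {n : ℕ} (hn : 0 < n) (q : Fin n → ℕ) (j : ℕ) :
    empirical q j = ((Finset.univ.filter fun i => q i = j).card : ℝ) / n := by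
  simp [empirical, hn.ne', div_eq_inv_mul]

theorem empirical_sub {n : ℕ} (hn : 0 < n) (q q' : Fin n → ℕ) (j : ℕ) :
    empirical q' j - empirical q j =
      (1 / (n : ℝ)) * ∑ i, ((if q' i = j then 1 else 0) - if q i = j then 1 else 0) := by
  simp only [empirical, hn.ne', if_false, ← mul_sub, Finset.sum_sub_distrib]

theorem empirical_arrive_sub {n : ℕ} (hn : 0 < n) (q : Fin n → ℕ) (B : Finset (Fin n)) (j : ℕ) :
    empirical (arrive q B) j - empirical q j =
      (1 / (n : ℝ)) * netInflow (fun i => (B.filter fun l => q l = i).card) j := by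
  rw [empirical_sub hn, ← Finset.sum_subset (Finset.subset_univ B)
    fun i _ hi => by simp [arrive, hi]]
  congr 1
  calc _ = ∑ l ∈ B, netInflow (fun i => if q l = i then 1 else 0) j := by
        refine Finset.sum_congr rfl fun l hl => ?_
        cases j <;> simp [arrive, hl, netInflow]
    _ = _ := by simp [← netInflow_sum]

theorem empirical_depart_sub {n : ℕ} (hn : 0 < n) (q : Fin n → ℕ) (i : Fin n) (j : ℕ) :
    empirical (depart q i) j - empirical q j =
      (1 / (n : ℝ)) * ((if q i - 1 = j then 1 else 0) - if q i = j then 1 else 0) := by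
  rw [empirical_sub hn, Finset.sum_eq_single i (fun l _ hl => by simp [depart, hl]) (by simp)]
  simp [depart]

theorem sum_depart_empirical {n : ℕ} (hn : 0 < n) (k : ℕ) (q : Fin n → ℕ) (j : ℕ) :
    ∑ i, (if 0 < q i then (k : ℝ) * (empirical (depart q i) j - empirical q j) else 0) =
      -(k * netInflow (fun j => empirical q (j + 1)) j) := by
  have h1 : ∀ i, (if 0 < q i then (k : ℝ) * (empirical (depart q i) j - empirical q j) else 0) =
      -(k * (1 / n * netInflow (fun j => if q i = j + 1 then 1 else 0) j)) := by
    intro i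
    rw [empirical_depart_sub hn]
    cases j <;> simp only [netInflow] <;> split_ifs <;> first | omega | simp
  rw [Finset.sum_congr rfl fun i _ => h1 i, Finset.sum_neg_distrib, ← Finset.mul_sum,
    ← Finset.mul_sum, ← netInflow_sum, ← netInflow_const_mul]
  simp [empirical, hn.ne']

theorem Routing.sum_prob_mul_empirical_arrive_sub {n L k : ℕ} (hn : 0 < n) (R : Routing n L k)
    (q : Fin n → ℕ) (j : ℕ) {A : Finset (Fin n)} (hA : A.card = L) :
    ∑ B, R.prob q A B * (empirical (arrive q B) j - empirical q j) =
      (1 / (n : ℝ)) * netInflow (fun i => routed k q i A) j := by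
  have h : ∀ B, R.prob q A B * (empirical (arrive q B) j - empirical q j) =
      R.prob q A B * ((1 / (n : ℝ)) * netInflow (fun i => routed k q i A) j) := by
    intro B
    by_cases hB : R.prob q A B = 0
    · rw [hB, zero_mul, zero_mul]
    · simp only [empirical_arrive_sub hn, (R.shortest q A B hA hB).card_filter_eq]
  rw [Finset.sum_congr rfl fun B _ => h B, ← Finset.sum_mul, R.sum_eq_one q A hA, one_mul]

/-- The mean number of jobs that a request sends to queues of length `j`. -/
def meanRouted {n : ℕ} (L k : ℕ) (q : Fin n → ℕ) (j : ℕ) : ℝ :=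
  (∑ A ∈ Finset.powersetCard L Finset.univ, (routed k q j A : ℝ)) / n.choose L

theorem generator_empirical {n L c k : ℕ} (hc : 1 ≤ c) (hn : 0 < n) (lam : ℝ)
    (S : Storage n L c) (R : Routing n L k) (j : ℕ) (q : Fin n → ℕ) :
    generator k lam S R (fun q => empirical q j) q =
      netInflow (fun i => lam * meanRouted L k q i - k * empirical q (i + 1)) j := by
  have hn' : (n : ℝ) ≠ 0 := by positivity
  have hmean : 1 / (S.numFiles : ℝ) * ∑ i, netInflow (fun l => (routed k q l (S.servers i) : ℝ)) j =
      netInflow (meanRouted L k q) j := by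
    rw [S.average_servers hc fun A => netInflow (fun l => (routed k q l A : ℝ)) j,
      ← netInflow_sum, div_eq_inv_mul, ← netInflow_const_mul]
    exact congrArg (netInflow · j) (funext fun l => (div_eq_inv_mul _ _).symm)
  rw [generator, sum_depart_empirical hn, Finset.sum_congr rfl fun i _ =>
      R.sum_prob_mul_empirical_arrive_sub hn q j (S.card_servers i), ← Finset.mul_sum,
    netInflow_sub, netInflow_const_mul, netInflow_const_mul, ← hmean]
  field_simp
  ring

/-! ### Sampling without and with replacement -/

theorem abs_prod_sub_prod_le {ι : Type*} (s : Finset ι) {x y : ι → ℝ}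
    (hx : ∀ i, x i ∈ Set.Icc (0 : ℝ) 1) (hy : ∀ i, y i ∈ Set.Icc (0 : ℝ) 1) :
    |∏ i ∈ s, x i - ∏ i ∈ s, y i| ≤ ∑ i ∈ s, |x i - y i| := by
  classical
  induction s using Finset.induction_on with
  | empty => simp
  | insert i s hi ih =>
    rw [Finset.prod_insert hi, Finset.prod_insert hi, Finset.sum_insert hi]
    have hprod : |∏ i ∈ s, x i| ≤ 1 := by
      rw [Finset.abs_prod]
      exact Finset.prod_le_one (fun i _ => abs_nonneg _)
        fun i _ => (abs_of_nonneg (hx i).1).trans_le (hx i).2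
    calc _ = |(x i - y i) * ∏ i ∈ s, x i + y i * (∏ i ∈ s, x i - ∏ i ∈ s, y i)| := by ring_nf
      _ ≤ |x i - y i| * |∏ i ∈ s, x i| + |y i| * |∏ i ∈ s, x i - ∏ i ∈ s, y i| := by
          rw [← abs_mul, ← abs_mul]
          exact abs_add_le _ _
      _ ≤ |x i - y i| * 1 + 1 * ∑ i ∈ s, |x i - y i| := by
          gcongr
          exact (abs_of_nonneg (hy i).1).trans_le (hy i).2
      _ = _ := by ring

theorem card_powerset_filter_fiber {α κ : Type*} [Fintype κ] [DecidableEq κ] (s : Finset α)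
    (f : α → κ) (m : κ → ℕ) :
    (s.powerset.filter fun A => ∀ c, (A.filter fun i => f i = c).card = m c).card =
      ∏ c, (s.filter fun i => f i = c).card.choose (m c) := by
  classical
  simp_rw [← Finset.card_powersetCard, ← Fintype.card_piFinset]
  refine Finset.card_nbij' (fun A c => A.filter fun i => f i = c) (Finset.univ.biUnion ·)
    (fun A hA => ?_) (fun U hU => ?_) (fun A _ => by ext i; simp) (fun U hU => funext fun c => ?_)
  all_goals simp only [Finset.coe_filter, Finset.mem_powerset, Set.mem_ofPred_eq, Finset.mem_coe,
    Fintype.mem_piFinset, Finset.mem_powersetCard] at *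
  · exact fun c => ⟨Finset.filter_subset_filter _ hA.1, hA.2 c⟩
  all_goals
    have hfiber : ∀ c, (Finset.univ.biUnion U).filter (fun i => f i = c) = U c := by
      intro c
      have hf : ∀ c, ∀ i ∈ U c, f i = c := fun c i hi => (Finset.mem_filter.1 ((hU c).1 hi)).2
      ext i
      simp only [Finset.mem_filter, Finset.mem_biUnion, Finset.mem_univ, true_and]
      exact ⟨fun ⟨⟨c', hi⟩, hc⟩ => (hf c' i hi ▸ hc) ▸ hi, fun hi => ⟨⟨c, hi⟩, hf c i hi⟩⟩
  · refine ⟨fun i hi => ?_, fun c => by rw [hfiber c, (hU c).2]⟩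
    obtain ⟨c, -, hi⟩ := Finset.mem_biUnion.1 hi
    exact Finset.filter_subset _ _ ((hU c).1 hi)
  · exact hfiber c

theorem descFactorial_div_mem_Icc {a n : ℕ} (ha : a ≤ n) (i : ℕ) :
    (a.descFactorial i : ℝ) / n ^ i ∈ Set.Icc (0 : ℝ) 1 := by
  refine ⟨by positivity, div_le_one_of_le₀ ?_ (by positivity)⟩
  exact_mod_cast (Nat.descFactorial_le_pow a i).trans (Nat.pow_le_pow_left ha i)

theorem natCast_div_mem_Icc {a n : ℕ} (ha : a ≤ n) : (a / n : ℝ) ∈ Set.Icc (0 : ℝ) 1 :=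
  ⟨by positivity, div_le_one_of_le₀ (by exact_mod_cast ha) (by positivity)⟩

theorem abs_descFactorial_div_sub_le {a n : ℕ} (ha : a ≤ n) (i : ℕ) :
    |(a.descFactorial i : ℝ) / n ^ i - (a / n : ℝ) ^ i| ≤ i ^ 2 / n := by
  have hfactor : (a.descFactorial i : ℝ) / n ^ i = ∏ l ∈ Finset.range i, ((a - l : ℕ) / n : ℝ) := by
    rw [Finset.prod_div_distrib, Nat.descFactorial_eq_prod_range, Nat.cast_prod]
    simp
  have hpow : (a / n : ℝ) ^ i = ∏ _l ∈ Finset.range i, (a / n : ℝ) := by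
    rw [Finset.prod_const, Finset.card_range]
  rw [hfactor, hpow]
  refine (abs_prod_sub_prod_le _ (fun l => natCast_div_mem_Icc ((Nat.sub_le _ _).trans ha))
    fun _ => natCast_div_mem_Icc ha).trans ?_
  calc _ ≤ ∑ _l ∈ Finset.range i, (i / n : ℝ) := by
        refine Finset.sum_le_sum fun l hl => ?_
        rw [← sub_div, abs_div, Nat.abs_cast]
        gcongr
        have h1 : ((a - l : ℕ) : ℝ) ≤ a := by exact_mod_cast Nat.sub_le _ _
        have h2 : (a : ℝ) ≤ (a - l : ℕ) + i := by
          have := Finset.mem_range.1 hl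
          exact_mod_cast (by omega : a ≤ a - l + i)
        rw [abs_le]
        constructor <;> linarith
    _ = _ := by
        rw [Finset.sum_const, Finset.card_range, nsmul_eq_mul]
        ring

theorem prod_choose_div_mul_descFactorial_div {κ : Type*} [Fintype κ] (N m : κ → ℕ) {n : ℕ}
    (hn : ∑ c, m c ≤ n) :
    (∏ c, ((N c).choose (m c) : ℝ)) / n.choose (∑ c, m c) *
        (n.descFactorial (∑ c, m c) / n ^ ∑ c, m c) =
      (∑ c, m c).factorial / (∏ c, ((m c).factorial : ℝ)) *
        ∏ c, ((N c).descFactorial (m c) : ℝ) / n ^ m c := by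
  have hchoose : (n.choose (∑ c, m c) : ℝ) ≠ 0 := by exact_mod_cast (Nat.choose_pos hn).ne'
  have hfact : (∏ c, ((m c).factorial : ℝ)) ≠ 0 :=
    Finset.prod_ne_zero_iff.2 fun c _ => by positivity
  simp only [Nat.descFactorial_eq_factorial_mul_choose, Nat.cast_mul, Finset.prod_div_distrib,
    Finset.prod_mul_distrib, Finset.prod_pow_eq_pow_sum]
  field_simp

theorem abs_prod_descFactorial_div_sub_le {κ : Type*} [Fintype κ] {N : κ → ℕ} (m : κ → ℕ) {n : ℕ}
    (hN : ∀ c, N c ≤ n) :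
    |∏ c, ((N c).descFactorial (m c) : ℝ) / n ^ m c - ∏ c, (N c / n : ℝ) ^ m c| ≤
      Fintype.card κ * ((∑ c, m c : ℕ) ^ 2 / n) := by
  calc _ ≤ ∑ c, |((N c).descFactorial (m c) : ℝ) / n ^ m c - (N c / n : ℝ) ^ m c| :=
        abs_prod_sub_prod_le _ (fun c => descFactorial_div_mem_Icc (hN c) _) fun c =>
          have := natCast_div_mem_Icc (hN c)
          ⟨pow_nonneg this.1 _, pow_le_one₀ this.1 this.2⟩
    _ ≤ ∑ _c : κ, ((∑ c, m c : ℕ) ^ 2 / n : ℝ) := by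
        refine Finset.sum_le_sum fun c _ => (abs_descFactorial_div_sub_le (hN c) _).trans ?_
        gcongr
        exact Finset.single_le_sum (fun c _ => Nat.zero_le (m c)) (Finset.mem_univ c)
    _ = _ := by simp

section Hypergeometric

variable {α κ : Type*} [Fintype α] [Fintype κ] [DecidableEq κ] (f : α → κ) (m : κ → ℕ)

theorem prod_choose_card_fiber_le :
    ∏ c, (Finset.univ.filter fun i => f i = c).card.choose (m c) ≤
      (Fintype.card α).choose (∑ c, m c) := by
  rw [← card_powerset_filter_fiber, ← Finset.card_univ, ← Finset.card_powersetCard]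
  refine Finset.card_le_card fun A hA => ?_
  have hfiber := (Finset.mem_filter.1 hA).2
  refine Finset.mem_powersetCard.2 ⟨Finset.subset_univ A, ?_⟩
  rw [Finset.card_eq_sum_card_fiberwise fun i _ => Finset.mem_coe.2 (Finset.mem_univ (f i))]
  exact Finset.sum_congr rfl fun c _ => hfiber c

theorem abs_hypergeometric_sub_multinomial_le (hm : ∑ c, m c ≤ Fintype.card α) :
    |(∏ c, ((Finset.univ.filter fun i => f i = c).card.choose (m c) : ℝ)) /
          (Fintype.card α).choose (∑ c, m c) -
        (∑ c, m c).factorial / (∏ c, ((m c).factorial : ℝ)) *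
          ∏ c, ((Finset.univ.filter fun i => f i = c).card / Fintype.card α : ℝ) ^ m c| ≤
      (1 + Fintype.card κ * (∑ c, m c).factorial) * (∑ c, m c : ℕ) ^ 2 / Fintype.card α := by
  have hN : ∀ c, (Finset.univ.filter fun i => f i = c).card ≤ Fintype.card α :=
    fun c => Finset.card_le_univ _
  have hle := prod_choose_card_fiber_le f m
  have hid := prod_choose_div_mul_descFactorial_div
    (fun c => (Finset.univ.filter fun i => f i = c).card) m hm
  set N := fun c => (Finset.univ.filter fun i => f i = c).card
  set n := Fintype.card α
  set M := ∑ c, m c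
  set ρ : ℝ := (∏ c, ((N c).choose (m c) : ℝ)) / n.choose M
  set μ : ℝ := M.factorial / (∏ c, ((m c).factorial : ℝ))
  have hρ : |ρ| ≤ 1 := by
    rw [abs_of_nonneg (by positivity)]
    exact div_le_one_of_le₀ (by exact_mod_cast hle) (by positivity)
  have hμ : |μ| ≤ M.factorial := by
    rw [abs_of_nonneg (by positivity)]
    refine div_le_self (by positivity) ?_
    exact_mod_cast Finset.one_le_prod' fun c _ => (m c).factorial_pos
  have hwith : |1 - (n.descFactorial M : ℝ) / n ^ M| ≤ M ^ 2 / n := by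
    rcases eq_or_ne n 0 with hn | hn
    · simp [show M = 0 by omega]
    · simpa [hn, abs_sub_comm] using abs_descFactorial_div_sub_le le_rfl (a := n) (n := n) M
  calc _ = |ρ * (1 - (n.descFactorial M : ℝ) / n ^ M) +
        μ * (∏ c, ((N c).descFactorial (m c) : ℝ) / n ^ m c - ∏ c, (N c / n : ℝ) ^ m c)| := by
        congr 1
        linear_combination hid
    _ ≤ 1 * (M ^ 2 / n) + M.factorial * (Fintype.card κ * (M ^ 2 / n)) := by
        refine (abs_add_le _ _).trans ?_
        rw [abs_mul, abs_mul]
        gcongr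
        exact abs_prod_descFactorial_div_sub_le m hN
    _ = _ := by ring

end Hypergeometric

/-! ### The polynomial behind `ζ̄` -/

/-- The pairs `(i₁, i₂)` over which `ζ̄` sums: `i₁` of the `L` sampled queues are shorter than a
given level, and `i₂` are at that level. -/
def zetaIndex (L k : ℕ) : Finset (Σ _ : ℕ, ℕ) :=
  (Finset.range k).sigma fun i₁ => Finset.Icc 1 (L - i₁)

/-- The numbers of sampled queues below, at, and above the level. -/
def sampleProfile (L : ℕ) (p : Σ _ : ℕ, ℕ) : Ordering → ℕ
  | .lt => p.1
  | .eq => p.2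
  | .gt => L - p.1 - p.2

/-- The coefficients of `zetaPoly`. -/
def zetaCoeff (L k : ℕ) (p : Σ _ : ℕ, ℕ) : ℝ :=
  (min p.2 (k - p.1) : ℕ) / ∏ c, ((sampleProfile L p c).factorial : ℝ)

/-- `ζ̄` as a polynomial in the masses `x` below, at, and above the level. -/
def zetaPoly (L k : ℕ) (x : Ordering → ℝ) : ℝ :=
  ∑ p ∈ zetaIndex L k, zetaCoeff L k p * ∏ c, x c ^ sampleProfile L p c

/-- The sum of the coefficients of `zetaPoly`. -/
def zetaMass (L k : ℕ) : ℝ := ∑ p ∈ zetaIndex L k, zetaCoeff L k p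

theorem mem_zetaIndex {L k : ℕ} {p : Σ _ : ℕ, ℕ} :
    p ∈ zetaIndex L k ↔ p.1 < k ∧ 1 ≤ p.2 ∧ p.1 + p.2 ≤ L := by
  simp only [zetaIndex, Finset.mem_sigma, Finset.mem_range, Finset.mem_Icc]
  omega

@[to_additive]
theorem prod_ordering {M : Type*} [CommMonoid M] (g : Ordering → M) :
    ∏ c, g c = g .lt * (g .eq * g .gt) := by
  simp [Finset.prod, Finset.univ, Fintype.elems]

theorem sum_sampleProfile {L k : ℕ} {p : Σ _ : ℕ, ℕ} (hp : p ∈ zetaIndex L k) :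
    ∑ c, sampleProfile L p c = L := by
  have := mem_zetaIndex.1 hp
  simp only [sum_ordering, sampleProfile]
  omega

theorem zetaCoeff_nonneg (L k : ℕ) (p : Σ _ : ℕ, ℕ) : 0 ≤ zetaCoeff L k p := by
  unfold zetaCoeff
  positivity

theorem zetaMass_nonneg (L k : ℕ) : 0 ≤ zetaMass L k :=
  Finset.sum_nonneg fun _ _ => zetaCoeff_nonneg _ _ _

theorem zetaPoly_mem_Icc (L k : ℕ) {x : Ordering → ℝ} (hx : ∀ c, x c ∈ Set.Icc (0 : ℝ) 1) :
    zetaPoly L k x ∈ Set.Icc 0 (zetaMass L k * x .eq) := by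
  have hpow : ∀ c i, x c ^ i ∈ Set.Icc (0 : ℝ) 1 :=
    fun c i => ⟨pow_nonneg (hx c).1 i, pow_le_one₀ (hx c).1 (hx c).2⟩
  refine ⟨Finset.sum_nonneg fun p _ => mul_nonneg (zetaCoeff_nonneg _ _ _)
    (Finset.prod_nonneg fun c _ => (hpow c _).1), ?_⟩
  rw [zetaMass, Finset.sum_mul]
  refine Finset.sum_le_sum fun p hp => mul_le_mul_of_nonneg_left ?_ (zetaCoeff_nonneg _ _ _)
  have heq : x .eq ^ p.2 ≤ x .eq :=
    pow_le_of_le_one (hx _).1 (hx _).2 (Nat.one_le_iff_ne_zero.1 (mem_zetaIndex.1 hp).2.1)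
  rw [prod_ordering]
  calc _ ≤ 1 * (x .eq * 1) := by
        gcongr
        · exact mul_nonneg (hpow _ _).1 (hpow _ _).1
        · exact (hpow _ _).2
        · exact (hpow _ _).1
        · exact (hx _).1
        · exact heq
        · exact (hpow _ _).2
    _ = _ := by ring

theorem abs_pow_sub_pow_le_mul {x y : ℝ} (hx : x ∈ Set.Icc (0 : ℝ) 1) (hy : y ∈ Set.Icc (0 : ℝ) 1)
    (i : ℕ) : |x ^ i - y ^ i| ≤ i * |x - y| := by
  calc _ ≤ |x - y| * i * max |x| |y| ^ (i - 1) := abs_pow_sub_pow_le x y i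
    _ ≤ |x - y| * i * 1 := by
        gcongr
        rw [abs_of_nonneg hx.1, abs_of_nonneg hy.1]
        exact pow_le_one₀ (le_max_of_le_left hx.1) (max_le hx.2 hy.2)
    _ = _ := by ring

theorem abs_zetaPoly_sub_le (L k : ℕ) {x y : Ordering → ℝ} (hx : ∀ c, x c ∈ Set.Icc (0 : ℝ) 1)
    (hy : ∀ c, y c ∈ Set.Icc (0 : ℝ) 1) :
    |zetaPoly L k x - zetaPoly L k y| ≤ zetaMass L k * (L * ∑ c, |x c - y c|) := by
  rw [zetaPoly, zetaPoly, ← Finset.sum_sub_distrib, zetaMass, Finset.sum_mul]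
  refine (Finset.abs_sum_le_sum_abs _ _).trans (Finset.sum_le_sum fun p hp => ?_)
  rw [← mul_sub, abs_mul, abs_of_nonneg (zetaCoeff_nonneg _ _ _), Finset.mul_sum]
  refine mul_le_mul_of_nonneg_left ?_ (zetaCoeff_nonneg _ _ _)
  refine (abs_prod_sub_prod_le _ (fun c => ⟨pow_nonneg (hx c).1 _, pow_le_one₀ (hx c).1 (hx c).2⟩)
    fun c => ⟨pow_nonneg (hy c).1 _, pow_le_one₀ (hy c).1 (hy c).2⟩).trans
    (Finset.sum_le_sum fun c _ => ?_)
  refine (abs_pow_sub_pow_le_mul (hx c) (hy c) _).trans ?_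
  gcongr
  calc sampleProfile L p c ≤ ∑ c, sampleProfile L p c :=
        Finset.single_le_sum (fun _ _ => Nat.zero_le _) (Finset.mem_univ c)
    _ = L := sum_sampleProfile hp

/-- The masses of `r` below, at, and above the level `j`, if the total mass is `1`. -/
def levelMass (r : ℕ → ℝ) (j : ℕ) : Ordering → ℝ
  | .lt => ∑ m ∈ Finset.range j, r m
  | .eq => r j
  | .gt => 1 - ∑ m ∈ Finset.range (j + 1), r m

theorem Simplex.zetaBar_eq (s : Simplex) (L k j : ℕ) :
    zetaBar L k j s = zetaPoly L k (levelMass s j) := by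
  have htail : ∑' m, s (j + 1 + m) = 1 - ∑ m ∈ Finset.range (j + 1), s m := by
    have hsplit := s.hasSum.summable.sum_add_tsum_nat_add (j + 1)
    rw [s.hasSum.tsum_eq] at hsplit
    simp_rw [add_comm (j + 1), ← hsplit, add_sub_cancel_left]
  rw [zetaBar, zetaPoly, zetaIndex, Finset.sum_sigma, htail]
  refine Finset.sum_congr rfl fun i₁ _ => ?_
  rw [Finset.mul_sum]
  refine Finset.sum_congr rfl fun i₂ _ => ?_
  simp only [zetaCoeff, sampleProfile, levelMass, prod_ordering]
  field_simp

theorem sum_range_empirical {n : ℕ} (hn : 0 < n) (q : Fin n → ℕ) (j : ℕ) :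
    ∑ m ∈ Finset.range j, empirical q m =
      ((Finset.univ.filter fun i => q i < j).card : ℝ) / n := by
  induction j with
  | zero => simp
  | succ j ih =>
    rw [Finset.sum_range_succ, ih, empirical_eq_card hn, card_filter_lt_succ]
    push_cast
    ring

theorem levelMass_empirical {n : ℕ} (hn : 0 < n) (q : Fin n → ℕ) (j : ℕ) (c : Ordering) :
    levelMass (empirical q) j c =
      ((Finset.univ.filter fun i => compare (q i) j = c).card : ℝ) / n := by
  cases c
  · simp only [levelMass, compare_lt_iff_lt, sum_range_empirical hn]
  · simp only [levelMass, compare_eq_iff_eq, empirical_eq_card hn]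
  · have hcard := Finset.card_filter_add_card_filter_not (s := (Finset.univ : Finset (Fin n)))
      (fun i => q i < j + 1)
    simp only [not_lt, Nat.succ_le_iff, Finset.card_univ, Fintype.card_fin] at hcard
    have hn' : (n : ℝ) ≠ 0 := by positivity
    simp only [levelMass, compare_gt_iff_gt, sum_range_empirical hn]
    rw [eq_div_iff hn', sub_mul, div_mul_cancel₀ _ hn', one_mul, sub_eq_iff_eq_add']
    exact_mod_cast hcard.symm

theorem routed_eq_sum {n L k : ℕ} (q : Fin n → ℕ) (j : ℕ) {A : Finset (Fin n)} (hA : A.card = L) :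
    routed k q j A = ∑ p ∈ zetaIndex L k,
      if ∀ c, (A.filter fun i => compare (q i) j = c).card = sampleProfile L p c then
        min p.2 (k - p.1) else 0 := by
  have hsum : A.card = ∑ c, (A.filter fun i => compare (q i) j = c).card :=
    Finset.card_eq_sum_card_fiberwise fun _ _ => Finset.mem_coe.2 (Finset.mem_univ _)
  simp only [sum_ordering, compare_lt_iff_lt, compare_eq_iff_eq, compare_gt_iff_gt] at hsum
  rw [routed]
  set a := (A.filter fun i => q i < j).card
  set b := (A.filter fun i => q i = j).card
  have hprofile : ∀ p ∈ zetaIndex L k,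
      (∀ c, (A.filter fun i => compare (q i) j = c).card = sampleProfile L p c) ↔ ⟨a, b⟩ = p := by
    rintro ⟨i₁, i₂⟩ hp
    have := mem_zetaIndex.1 hp
    simp only [Ordering.forall, compare_lt_iff_lt, compare_eq_iff_eq, compare_gt_iff_gt,
      sampleProfile, Sigma.mk.injEq, heq_eq_eq]
    omega
  rw [Finset.sum_congr rfl fun p hp => if_congr (hprofile p hp) rfl rfl, Finset.sum_ite_eq]
  split_ifs with h
  · rfl
  · rw [mem_zetaIndex] at h
    dsimp only at h
    omega

theorem sum_routed (n L k : ℕ) (q : Fin n → ℕ) (j : ℕ) :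
    ∑ A ∈ Finset.powersetCard L Finset.univ, routed k q j A =
      ∑ p ∈ zetaIndex L k, min p.2 (k - p.1) *
        ∏ c, (Finset.univ.filter fun i => compare (q i) j = c).card.choose
          (sampleProfile L p c) := by
  rw [Finset.sum_congr rfl fun A hA => routed_eq_sum q j (Finset.mem_powersetCard.1 hA).2,
    Finset.sum_comm]
  refine Finset.sum_congr rfl fun p hp => ?_
  rw [← Finset.sum_filter, Finset.sum_const, smul_eq_mul, mul_comm, ← card_powerset_filter_fiber]
  congr 2
  ext A
  simp only [Finset.mem_filter, Finset.mem_powersetCard, Finset.mem_powerset]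
  refine ⟨fun ⟨h, hfiber⟩ => ⟨h.1, hfiber⟩, fun ⟨h, hfiber⟩ => ⟨⟨h, ?_⟩, hfiber⟩⟩
  rw [← sum_sampleProfile hp, Finset.card_eq_sum_card_fiberwise (f := fun i => compare (q i) j)
    fun _ _ => Finset.mem_coe.2 (Finset.mem_univ _)]
  exact Finset.sum_congr rfl fun c _ => hfiber c

/-- The constant in the comparison of sampling without and with replacement. -/
def samplingConst (L k : ℕ) : ℝ :=
  ∑ p ∈ zetaIndex L k, (min p.2 (k - p.1) : ℕ) * ((1 + 3 * L.factorial) * (L : ℝ) ^ 2)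

theorem abs_meanRouted_sub_le {n L k : ℕ} (hn : L ≤ n) (hn0 : 0 < n) (q : Fin n → ℕ) (j : ℕ) :
    |meanRouted L k q j - L.factorial * zetaPoly L k (levelMass (empirical q) j)| ≤
      samplingConst L k / n := by
  rw [meanRouted, ← Nat.cast_sum, sum_routed, zetaPoly, Nat.cast_sum, Finset.sum_div,
    Finset.mul_sum, ← Finset.sum_sub_distrib, samplingConst, Finset.sum_div]
  refine (Finset.abs_sum_le_sum_abs _ _).trans (Finset.sum_le_sum fun p hp => ?_)
  have hsum := sum_sampleProfile hp
  have hcompare := abs_hypergeometric_sub_multinomial_le (fun i => compare (q i) j)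
    (sampleProfile L p) (by rwa [hsum, Fintype.card_fin])
  rw [hsum, Fintype.card_fin, show (Fintype.card Ordering : ℝ) = 3 by rfl] at hcompare
  simp only [levelMass_empirical hn0]
  rw [mul_div_assoc]
  refine (le_of_eq ?_).trans (mul_le_mul_of_nonneg_left hcompare (Nat.cast_nonneg _))
  conv_rhs => rw [← Nat.abs_cast (min p.2 (k - p.1)), ← abs_mul]
  rw [zetaCoeff]
  push_cast
  congr 1
  ring

/-! ### The drift as a net inflow -/

/-- The net rate at which mass crosses from the levels `≤ j` to the levels `> j`. Since `levelMass`
only involves coordinates up to `j`, this makes sense for every sequence. -/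
def flux (L k : ℕ) (lam : ℝ) (r : ℕ → ℝ) (j : ℕ) : ℝ :=
  lam * (L.factorial * zetaPoly L k (levelMass r j)) - k * r (j + 1)

theorem Simplex.driftCoord_eq (L k : ℕ) (lam : ℝ) (s : Simplex) (j : ℕ) :
    driftCoord L k lam s j = netInflow (flux L k lam s) j := by
  cases j <;>
    simp only [driftCoord, zetaBarDelta, netInflow, flux, s.zetaBar_eq, if_true, Nat.succ_ne_zero,
      if_false, Nat.add_sub_cancel] <;>
    ring

theorem abs_generator_empirical_sub_le {n L c k : ℕ} (hc : 1 ≤ c) (hn : L ≤ n) (hn0 : 0 < n)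
    {lam : ℝ} (hlam : 0 ≤ lam) (S : Storage n L c) (R : Routing n L k) (q : Fin n → ℕ) (j : ℕ) :
    |generator k lam S R (fun q => empirical q j) q - netInflow (flux L k lam (empirical q)) j| ≤
      2 * (lam * (samplingConst L k / n)) := by
  rw [generator_empirical hc hn0, ← netInflow_sub]
  refine abs_netInflow_le (fun i => ?_) j
  rw [flux, sub_sub_sub_cancel_right, ← mul_sub, abs_mul, abs_of_nonneg hlam]
  exact mul_le_mul_of_nonneg_left (abs_meanRouted_sub_le hn hn0 q i) hlam

theorem continuous_flux (L k : ℕ) (lam : ℝ) (j : ℕ) :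
    Continuous fun r : ℕ → ℝ => flux L k lam r j := by
  have hmass : ∀ c, Continuous fun r : ℕ → ℝ => levelMass r j c := fun c => by
    cases c <;> simp only [levelMass] <;> fun_prop
  simp only [flux, zetaPoly]
  fun_prop

theorem continuous_netInflow_flux (L k : ℕ) (lam : ℝ) (j : ℕ) :
    Continuous fun r : ℕ → ℝ => netInflow (flux L k lam r) j := by
  have hflux := continuous_flux L k lam
  cases j <;> simp only [netInflow] <;> fun_prop

/-- The sub-probability vectors on `ℕ`. Unlike the simplex they form a closed set of sequences for
pointwise convergence. -/
def subSimplex : Set (ℕ → ℝ) := {r | (∀ j, 0 ≤ r j) ∧ ∀ J, ∑ j ∈ Finset.range J, r j ≤ 1}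

theorem isClosed_subSimplex : IsClosed subSimplex := by
  simp only [subSimplex, Set.ofPred_and, Set.ofPred_forall]
  exact (isClosed_iInter fun _ => isClosed_le (by fun_prop) (by fun_prop)).inter
    (isClosed_iInter fun _ => isClosed_le (by fun_prop) (by fun_prop))

theorem Simplex.mem_subSimplex (s : Simplex) : (s : ℕ → ℝ) ∈ subSimplex :=
  ⟨s.nonneg, fun _ => sum_le_hasSum _ (fun j _ => s.nonneg j) s.hasSum⟩

theorem levelMass_mem_Icc {r : ℕ → ℝ} (hr : r ∈ subSimplex) (j : ℕ) (c : Ordering) :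
    levelMass r j c ∈ Set.Icc (0 : ℝ) 1 := by
  have hsum : ∀ J, 0 ≤ ∑ m ∈ Finset.range J, r m := fun J => Finset.sum_nonneg fun m _ => hr.1 m
  have hj := hr.2 (j + 1)
  cases c <;> simp only [levelMass, Set.mem_Icc]
  · exact ⟨hsum j, hr.2 j⟩
  · rw [Finset.sum_range_succ] at hj
    exact ⟨hr.1 j, by linarith [hsum j]⟩
  · exact ⟨by linarith, by linarith [hsum (j + 1)]⟩

section
variable {L k : ℕ} {lam : ℝ}

theorem abs_flux_le (hlam : 0 ≤ lam) {r : ℕ → ℝ} (hr : r ∈ subSimplex) (j : ℕ) :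
    |flux L k lam r j| ≤ lam * (L.factorial * zetaMass L k) * r j + k * r (j + 1) := by
  obtain ⟨hpoly0, hpoly⟩ := zetaPoly_mem_Icc L k (levelMass_mem_Icc hr j)
  refine (abs_sub _ _).trans ?_
  rw [abs_of_nonneg (by positivity), abs_of_nonneg (mul_nonneg k.cast_nonneg (hr.1 _)), mul_assoc,
    mul_assoc]
  gcongr
  exact hpoly

/-- A bound on the `ℓ₁` norm of the drift on `subSimplex`. -/
def driftBound (L k : ℕ) (lam : ℝ) : ℝ := 2 * (lam * (L.factorial * zetaMass L k) + k)

theorem driftBound_nonneg (L k : ℕ) (hlam : 0 ≤ lam) : 0 ≤ driftBound L k lam := by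
  have := zetaMass_nonneg L k
  unfold driftBound
  positivity

theorem abs_flux_le_driftBound (hlam : 0 ≤ lam) {r : ℕ → ℝ} (hr : r ∈ subSimplex) (j : ℕ) :
    |flux L k lam r j| ≤ driftBound L k lam := by
  have hW := zetaMass_nonneg L k
  have hmass : 0 ≤ lam * (L.factorial * zetaMass L k) + k := by positivity
  calc |flux L k lam r j| ≤ lam * (L.factorial * zetaMass L k) * r j + k * r (j + 1) :=
        abs_flux_le hlam hr j
    _ ≤ lam * (L.factorial * zetaMass L k) * 1 + k * 1 := by
        gcongr
        exacts [(levelMass_mem_Icc hr j .eq).2, (levelMass_mem_Icc hr (j + 1) .eq).2]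
    _ ≤ driftBound L k lam := by
        unfold driftBound
        linarith

theorem sum_abs_netInflow_flux_le (hlam : 0 ≤ lam) {r : ℕ → ℝ} (hr : r ∈ subSimplex) (J : ℕ) :
    ∑ j ∈ Finset.range J, |netInflow (flux L k lam r) j| ≤ driftBound L k lam := by
  have hW := zetaMass_nonneg L k
  have hshift : ∑ j ∈ Finset.range J, r (j + 1) ≤ 1 := by
    have h := hr.2 (J + 1)
    rw [Finset.sum_range_succ'] at h
    linarith [hr.1 0]
  have habel := sum_range_abs_netInflow_mul_le (flux L k lam r) (fun _ => zero_le_one)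
    antitone_const J
  simp only [mul_one] at habel
  refine habel.trans (mul_le_mul_of_nonneg_left ?_ zero_le_two)
  calc ∑ j ∈ Finset.range J, |flux L k lam r j|
      ≤ ∑ j ∈ Finset.range J, (lam * (L.factorial * zetaMass L k) * r j + k * r (j + 1)) :=
        Finset.sum_le_sum fun j _ => abs_flux_le hlam hr j
    _ = lam * (L.factorial * zetaMass L k) * ∑ j ∈ Finset.range J, r j +
          k * ∑ j ∈ Finset.range J, r (j + 1) := by
        rw [Finset.sum_add_distrib, Finset.mul_sum, Finset.mul_sum]
    _ ≤ lam * (L.factorial * zetaMass L k) * 1 + k * 1 := by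
        gcongr
        exact hr.2 J
    _ = lam * (L.factorial * zetaMass L k) + k := by rw [mul_one, mul_one]

theorem abs_netInflow_flux_le (hlam : 0 ≤ lam) {r : ℕ → ℝ} (hr : r ∈ subSimplex) (j : ℕ) :
    |netInflow (flux L k lam r) j| ≤ driftBound L k lam :=
  (Finset.single_le_sum (f := fun j => |netInflow (flux L k lam r) j|) (fun _ _ => abs_nonneg _)
    (Finset.self_mem_range_succ j)).trans (sum_abs_netInflow_flux_le hlam hr (j + 1))

theorem sum_abs_levelMass_sub_le (r r' : ℕ → ℝ) (j : ℕ) :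
    ∑ c, |levelMass r j c - levelMass r' j c| ≤ 2 * ∑ m ∈ Finset.range (j + 1), |r m - r' m| := by
  have hsum : ∀ J, |∑ m ∈ Finset.range J, r m - ∑ m ∈ Finset.range J, r' m| ≤
      ∑ m ∈ Finset.range J, |r m - r' m| := fun J => by
    rw [← Finset.sum_sub_distrib]
    exact Finset.abs_sum_le_sum_abs _ _
  have hgt := hsum (j + 1)
  have hsucc := Finset.sum_range_succ (fun m => |r m - r' m|) j
  rw [abs_sub_comm] at hgt
  simp only [sum_ordering, levelMass, sub_sub_sub_cancel_left]
  linarith [hsum j]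

/-- A Lipschitz constant of `flux` at any level, as a function of the coordinates it depends on. -/
def fluxLip (L k : ℕ) (lam : ℝ) : ℝ := 2 * (lam * (L.factorial * (zetaMass L k * L))) + k

theorem fluxLip_nonneg (L k : ℕ) (hlam : 0 ≤ lam) : 0 ≤ fluxLip L k lam := by
  have := zetaMass_nonneg L k
  unfold fluxLip
  positivity

theorem abs_flux_sub_le (hlam : 0 ≤ lam) {r r' : ℕ → ℝ} (hr : r ∈ subSimplex)
    (hr' : r' ∈ subSimplex) (j : ℕ) :
    |flux L k lam r j - flux L k lam r' j| ≤
      fluxLip L k lam * ∑ m ∈ Finset.range (j + 2), |r m - r' m| := by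
  have hW := zetaMass_nonneg L k
  have hpoly : |zetaPoly L k (levelMass r j) - zetaPoly L k (levelMass r' j)| ≤
      zetaMass L k * (L * (2 * ∑ m ∈ Finset.range (j + 1), |r m - r' m|)) :=
    (abs_zetaPoly_sub_le L k (levelMass_mem_Icc hr j) (levelMass_mem_Icc hr' j)).trans (by
      gcongr
      exact sum_abs_levelMass_sub_le r r' j)
  have hE : ∑ m ∈ Finset.range (j + 1), |r m - r' m| ≤ ∑ m ∈ Finset.range (j + 2), |r m - r' m| :=
    Finset.sum_le_sum_of_subset_of_nonneg (by simp) fun _ _ _ => abs_nonneg _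
  have hlast : |r (j + 1) - r' (j + 1)| ≤ ∑ m ∈ Finset.range (j + 2), |r m - r' m| :=
    Finset.single_le_sum (f := fun m => |r m - r' m|) (fun _ _ => abs_nonneg _) (by simp)
  calc |flux L k lam r j - flux L k lam r' j|
      = |lam * (L.factorial * (zetaPoly L k (levelMass r j) - zetaPoly L k (levelMass r' j))) -
          k * (r (j + 1) - r' (j + 1))| := by
        congr 1
        unfold flux
        ring
    _ ≤ lam * (L.factorial * |zetaPoly L k (levelMass r j) - zetaPoly L k (levelMass r' j)|) +
          k * |r (j + 1) - r' (j + 1)| := by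
        refine (abs_sub _ _).trans_eq ?_
        rw [abs_mul, abs_mul, abs_mul, abs_of_nonneg hlam, Nat.abs_cast, Nat.abs_cast]
    _ ≤ lam * (L.factorial *
          (zetaMass L k * (L * (2 * ∑ m ∈ Finset.range (j + 2), |r m - r' m|)))) +
          k * ∑ m ∈ Finset.range (j + 2), |r m - r' m| := by
        gcongr
        exact hpoly.trans (by gcongr)
    _ = fluxLip L k lam * ∑ m ∈ Finset.range (j + 2), |r m - r' m| := by
        unfold fluxLip
        ring

theorem sum_partial_sums_div_two_pow (δ : ℕ → ℝ) (J : ℕ) :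
    ∑ j ∈ Finset.range J, (∑ m ∈ Finset.range (j + 2), δ m) / 2 ^ j =
      4 * ∑ m ∈ Finset.range (J + 1), δ m / 2 ^ m -
        2 * (∑ m ∈ Finset.range (J + 1), δ m) / 2 ^ J - 2 * δ 0 := by
  induction J with
  | zero =>
    simp only [Finset.sum_range_zero, Finset.sum_range_one, zero_add, pow_zero, div_one]
    ring
  | succ J ih =>
    rw [Finset.sum_range_succ, ih, Finset.sum_range_succ (fun m => δ m / 2 ^ m) (J + 1),
      Finset.sum_range_succ δ (J + 1), pow_succ]
    field_simp
    ring

/-- A Lipschitz constant of the drift on the simplex, for the metric `d₀`. -/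
def driftLip (L k : ℕ) (lam : ℝ) : ℝ := 8 * fluxLip L k lam

theorem Simplex.sum_range_le_dist (s t : Simplex) (J : ℕ) :
    ∑ j ∈ Finset.range J, |s j - t j| / 2 ^ j ≤ dist s t :=
  (summable_dist s t).sum_le_tsum _ fun _ _ => by positivity

theorem Simplex.sum_abs_netInflow_flux_sub_le (hlam : 0 ≤ lam) (s t : Simplex) (J : ℕ) :
    ∑ j ∈ Finset.range J, |netInflow (flux L k lam s) j - netInflow (flux L k lam t) j| / 2 ^ j ≤
      driftLip L k lam * dist s t := by
  have hC := fluxLip_nonneg L k hlam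
  have habel := sum_range_abs_netInflow_mul_le (fun j => flux L k lam s j - flux L k lam t j)
    (w := fun j => ((2 : ℝ) ^ j)⁻¹) (fun _ => by positivity)
    (fun i j hij => inv_anti₀ (by positivity) (pow_le_pow_right₀ one_le_two hij)) J
  simp only [netInflow_sub, ← div_eq_mul_inv] at habel
  refine habel.trans ?_
  calc 2 * ∑ j ∈ Finset.range J, |flux L k lam s j - flux L k lam t j| / 2 ^ j
      ≤ 2 * ∑ j ∈ Finset.range J,
          fluxLip L k lam * (∑ m ∈ Finset.range (j + 2), |s m - t m|) / 2 ^ j := by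
        gcongr
        exact abs_flux_sub_le hlam s.mem_subSimplex t.mem_subSimplex _
    _ = 2 * fluxLip L k lam *
          ∑ j ∈ Finset.range J, (∑ m ∈ Finset.range (j + 2), |s m - t m|) / 2 ^ j := by
        simp_rw [mul_div_assoc, ← Finset.mul_sum, mul_assoc]
    _ ≤ 2 * fluxLip L k lam * (4 * ∑ m ∈ Finset.range (J + 1), |s m - t m| / 2 ^ m) := by
        rw [sum_partial_sums_div_two_pow]
        gcongr
        have hpartial : 0 ≤ 2 * (∑ m ∈ Finset.range (J + 1), |s m - t m|) / 2 ^ J := by positivity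
        linarith [abs_nonneg (s 0 - t 0)]
    _ ≤ 2 * fluxLip L k lam * (4 * dist s t) := by
        gcongr
        exact s.sum_range_le_dist t _
    _ = driftLip L k lam * dist s t := by
        unfold driftLip
        ring

end

/-! ### Stability of approximate solutions -/

theorem le_mul_exp_of_le_add_timeIntegral {T : ℝ} (hT : 0 ≤ T) {D : Set.Icc (0 : ℝ) T → ℝ}
    (hD : ∀ t, ContinuousWithinAt D (Set.Ici t) t) {C a K : ℝ} (hC : ∀ t, |D t| ≤ C) (hK : 0 ≤ K)
    (h : ∀ t, D t ≤ a + K * timeIntegral hT D t) (t : Set.Icc (0 : ℝ) T) :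
    D t ≤ a * Real.exp (K * t) := by
  have hint := intervalIntegrable_IccExtend hT hD hC
  let W : ℝ → ℝ := fun s => a + K * ∫ u in (0 : ℝ)..s, Set.IccExtend hT D u
  have hDW : ∀ s ∈ Set.Icc 0 T, Set.IccExtend hT D s ≤ W s := fun s hs => by
    rw [Set.IccExtend_of_mem hT D hs]
    exact h ⟨s, hs⟩
  have hW : Continuous W :=
    continuous_const.add (continuous_const.mul (intervalIntegral.continuous_primitive hint 0))
  have hW' : ∀ s, HasDerivWithinAt W (K * Set.IccExtend hT D s) (Set.Ici s) s := fun s =>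
    ((intervalIntegral.integral_hasDerivWithinAt_right (hint 0 s)
      (measurable_IccExtend hT hD).stronglyMeasurable.stronglyMeasurableAtFilter
      ((rightCts_IccExtend hT hD s).mono Set.Ioi_subset_Ici_self)).const_mul K).const_add a
  have hgronwall := le_gronwallBound_of_liminf_deriv_right_le (δ := a) (ε := 0) hW.continuousOn
    (fun s _ r hr => (hW' s).liminf_right_slope_le hr) (by simp [W])
    (fun s hs => by
      rw [add_zero]
      exact mul_le_mul_of_nonneg_left (hDW s (Set.Ico_subset_Icc_self hs)) hK) t t.2
  rw [sub_zero, gronwallBound_ε0] at hgronwall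
  exact (h t).trans hgronwall

theorem Simplex.abs_dist_le_two (s t : Simplex) : |dist s t| ≤ 2 := by
  have h : dist s t ≤ 1 + 1 := hasSum_le (fun j => (div_le_self (abs_nonneg _)
    (one_le_pow₀ one_le_two)).trans (abs_sub _ _)) (summable_dist s t).hasSum
    (by simpa only [abs_of_nonneg (nonneg _ _)] using s.hasSum.add t.hasSum)
  rwa [abs_of_nonneg dist_nonneg, ← one_add_one_eq_two]

theorem Simplex.mem_Icc (s : Simplex) (j : ℕ) : s j ∈ Set.Icc (0 : ℝ) 1 :=
  levelMass_mem_Icc s.mem_subSimplex j .eq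

theorem Simplex.abs_sub_le_dist (s t : Simplex) (j : ℕ) : |s j - t j| ≤ 2 ^ j * dist s t := by
  rw [← div_le_iff₀' (by positivity)]
  exact (summable_dist s t).le_tsum j fun _ _ => by positivity

theorem Simplex.tendsto_iff {ι : Type*} {l : Filter ι} {x : ι → Simplex} {s : Simplex} :
    Tendsto x l (𝓝 s) ↔ Tendsto (fun i => (x i : ℕ → ℝ)) l (𝓝 s) := by
  rw [tendsto_iff_dist_tendsto_zero, tendsto_pi_nhds]
  constructor <;> intro h
  · intro j
    refine tendsto_iff_dist_tendsto_zero.2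
      (squeeze_zero (fun _ => dist_nonneg) (fun i => (x i).abs_sub_le_dist s j) ?_)
    simpa using h.const_mul (2 ^ j)
  · have hterm : ∀ j, Tendsto (fun i => |x i j - s j| / 2 ^ j) l (𝓝 0) := fun j => by
      simpa using ((h j).sub_const (s j)).abs.div_const (2 ^ j)
    rw [← tsum_zero (α := ℝ) (β := ℕ)]
    refine tendsto_tsum_of_dominated_convergence summable_geometric_two hterm
      (Eventually.of_forall fun i j => ?_)
    rw [Real.norm_of_nonneg (by positivity), one_div_pow]
    gcongr
    simpa [Real.dist_eq] using Real.dist_le_of_mem_Icc_01 ((x i).mem_Icc j) (s.mem_Icc j)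

theorem Simplex.continuous_coe : Continuous fun s : Simplex => (s : ℕ → ℝ) :=
  continuous_iff_continuousAt.2 fun _ => tendsto_iff.1 tendsto_id

section
variable {L k : ℕ} {lam T : ℝ} {hT : 0 ≤ T}

theorem rightCts_netInflow_flux (L k : ℕ) (lam : ℝ) (x : Cadlag T Simplex) (j : ℕ)
    (t : Set.Icc (0 : ℝ) T) :
    ContinuousWithinAt (fun s => netInflow (flux L k lam (x s)) j) (Set.Ici t) t :=
  ((continuous_netInflow_flux L k lam j).comp
    Simplex.continuous_coe).continuousAt.comp_continuousWithinAt (x.rightCts t)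

/-- The amount by which the path `x` fails to satisfy the `j`-th coordinate of the integral equation
`x(t) = x₀ + ∫₀ᵗ F(x(s)) ds`. -/
def defect (L k : ℕ) (lam : ℝ) (hT : 0 ≤ T) (x₀ : Simplex) (x : Cadlag T Simplex)
    (t : Set.Icc (0 : ℝ) T) (j : ℕ) : ℝ :=
  x t j - x₀ j - timeIntegral hT (fun s => netInflow (flux L k lam (x s)) j) t

/-- `x` solves `ẋ = F(x)`, `x(0) = x₀` on `[0,T]` up to an error `ε` in the metric `d₀`. -/
def IsApproxSolution (L k : ℕ) (lam : ℝ) (hT : 0 ≤ T) (x₀ : Simplex) (x : Cadlag T Simplex)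
    (ε : ℝ) : Prop :=
  ∀ t J, ∑ j ∈ Finset.range J, |defect L k lam hT x₀ x t j| / 2 ^ j ≤ ε

theorem IsApproxSolution.abs_defect_le {x₀ : Simplex} {x : Cadlag T Simplex} {ε : ℝ}
    (hx : IsApproxSolution L k lam hT x₀ x ε) (t : Set.Icc (0 : ℝ) T) (j : ℕ) :
    |defect L k lam hT x₀ x t j| ≤ ε * 2 ^ j := by
  rw [← div_le_iff₀ (by positivity)]
  exact (Finset.single_le_sum (f := fun j => |defect L k lam hT x₀ x t j| / 2 ^ j)
    (fun _ _ => by positivity) (Finset.self_mem_range_succ j)).trans (hx t (j + 1))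

theorem abs_apply_sub_apply_le (hlam : 0 ≤ lam) (x₀ y₀ : Simplex) (x y : Cadlag T Simplex)
    (t : Set.Icc (0 : ℝ) T) (j : ℕ) :
    |x t j - y t j| ≤ |defect L k lam hT x₀ x t j| + |defect L k lam hT y₀ y t j| + |x₀ j - y₀ j| +
      timeIntegral hT
        (fun s => |netInflow (flux L k lam (x s)) j - netInflow (flux L k lam (y s)) j|) t := by
  have hint : ∀ w : Cadlag T Simplex, ∀ a b, IntervalIntegrable
      (Set.IccExtend hT fun s => netInflow (flux L k lam (w s)) j) volume a b := fun w =>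
    intervalIntegrable_IccExtend hT (rightCts_netInflow_flux L k lam w j) fun s =>
      abs_netInflow_flux_le hlam (w s).mem_subSimplex j
  have hdrift : |timeIntegral hT (fun s => netInflow (flux L k lam (x s)) j) t -
      timeIntegral hT (fun s => netInflow (flux L k lam (y s)) j) t| ≤ timeIntegral hT
        (fun s => |netInflow (flux L k lam (x s)) j - netInflow (flux L k lam (y s)) j|) t := by
    rw [timeIntegral, timeIntegral, ← intervalIntegral.integral_sub (hint x _ _) (hint y _ _)]
    exact intervalIntegral.abs_integral_le_integral_abs t.2.1
  calc |x t j - y t j|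
      = |defect L k lam hT x₀ x t j - defect L k lam hT y₀ y t j + (x₀ j - y₀ j) +
          (timeIntegral hT (fun s => netInflow (flux L k lam (x s)) j) t -
            timeIntegral hT (fun s => netInflow (flux L k lam (y s)) j) t)| := by
        congr 1
        unfold defect
        ring
    _ ≤ _ := (abs_add_le _ _).trans
        (add_le_add ((abs_add_le _ _).trans (add_le_add_left (abs_sub _ _) _)) hdrift)

theorem rightCts_dist (x y : Cadlag T Simplex) (t : Set.Icc (0 : ℝ) T) :
    ContinuousWithinAt (fun s => dist (x s) (y s)) (Set.Ici t) t :=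
  (x.rightCts t).dist (y.rightCts t)

theorem sum_timeIntegral_abs_sub_le (hlam : 0 ≤ lam) (x y : Cadlag T Simplex)
    (t : Set.Icc (0 : ℝ) T) (J : ℕ) :
    ∑ j ∈ Finset.range J, timeIntegral hT
        (fun s => |netInflow (flux L k lam (x s)) j - netInflow (flux L k lam (y s)) j|) t / 2 ^ j ≤
      driftLip L k lam * timeIntegral hT (fun s => dist (x s) (y s)) t := by
  let u : ℕ → ℝ → ℝ := fun j s => Set.IccExtend hT
    (fun s => |netInflow (flux L k lam (x s)) j - netInflow (flux L k lam (y s)) j|) s / 2 ^ j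
  have hu : ∀ j, IntervalIntegrable (u j) volume 0 t := fun j =>
    (intervalIntegrable_IccExtend hT (C := driftBound L k lam + driftBound L k lam)
      (fun s => ((rightCts_netInflow_flux L k lam x j s).sub
        (rightCts_netInflow_flux L k lam y j s)).abs)
      (fun s => by
        rw [abs_abs]
        exact (abs_sub _ _).trans
          (add_le_add (abs_netInflow_flux_le hlam (x s).mem_subSimplex j)
            (abs_netInflow_flux_le hlam (y s).mem_subSimplex j))) 0 t).div_const _
  have hdist : IntervalIntegrable (Set.IccExtend hT fun s => dist (x s) (y s)) volume 0 t :=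
    intervalIntegrable_IccExtend hT (rightCts_dist x y)
      (fun s => Simplex.abs_dist_le_two _ _) 0 t
  simp only [timeIntegral, ← intervalIntegral.integral_div, ← intervalIntegral.integral_const_mul]
  rw [← intervalIntegral.integral_finsetSum fun j _ => hu j]
  exact intervalIntegral.integral_mono t.2.1
    (by simpa only [Finset.sum_fn] using IntervalIntegrable.sum (Finset.range J) fun j _ => hu j)
    (hdist.const_mul _) fun s => Simplex.sum_abs_netInflow_flux_sub_le hlam _ _ J

/-- The constant in the comparison of approximate solutions on `[0,T]`. -/
def growthConst (L k : ℕ) (lam T : ℝ) : ℝ := Real.exp (driftLip L k lam * T)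

theorem IsApproxSolution.dist_le (hlam : 0 ≤ lam) {x₀ y₀ : Simplex} {x y : Cadlag T Simplex}
    {ε ε' : ℝ} (hx : IsApproxSolution L k lam hT x₀ x ε)
    (hy : IsApproxSolution L k lam hT y₀ y ε') (t : Set.Icc (0 : ℝ) T) :
    dist (x t) (y t) ≤ (ε + ε' + dist x₀ y₀) * growthConst L k lam T := by
  have hε : 0 ≤ ε := hx t 0
  have hε' : 0 ≤ ε' := hy t 0
  have hlip : 0 ≤ driftLip L k lam := mul_nonneg (by norm_num) (fluxLip_nonneg L k hlam)
  have hintegral : ∀ t, dist (x t) (y t) ≤ (ε + ε' + dist x₀ y₀) +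
      driftLip L k lam * timeIntegral hT (fun s => dist (x s) (y s)) t := fun t => by
    refine (Simplex.summable_dist _ _).tsum_le_of_sum_range_le fun J => ?_
    refine (Finset.sum_le_sum fun j _ => div_le_div_of_nonneg_right
      (abs_apply_sub_apply_le (L := L) (k := k) (hT := hT) hlam x₀ y₀ x y t j)
      (by positivity)).trans ?_
    simp only [add_div, Finset.sum_add_distrib]
    gcongr
    · exact hx t J
    · exact hy t J
    · exact x₀.sum_range_le_dist y₀ J
    · exact sum_timeIntegral_abs_sub_le hlam x y t J
  refine (le_mul_exp_of_le_add_timeIntegral hT (rightCts_dist x y)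
    (fun s => Simplex.abs_dist_le_two _ _) hlip hintegral t).trans ?_
  unfold growthConst
  gcongr
  exact t.2.2

end

/-! ### Limits of approximate solutions -/

section
variable {L k : ℕ} {lam T : ℝ} {hT : 0 ≤ T}

/-- `z` solves `ż = F(z)`, `z(0) = z₀` coordinatewise, in integral form. The values of `z` need not
be in the simplex, so that this makes sense for a limit before its total mass is known. -/
def IsCoordSolution (L k : ℕ) (lam : ℝ) (hT : 0 ≤ T) (z₀ : ℕ → ℝ) (z : Set.Icc (0 : ℝ) T → ℕ → ℝ) :
    Prop :=
  ∀ t j, z t j = z₀ j + timeIntegral hT (fun s => netInflow (flux L k lam (z s)) j) t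

section Approximation
variable {π₀ : Simplex} {x₀ : ℕ → Simplex} {x : ℕ → Cadlag T Simplex} {ε : ℕ → ℝ}

theorem exists_tendsto_of_isApproxSolution (hlam : 0 ≤ lam)
    (hx : ∀ n, IsApproxSolution L k lam hT (x₀ n) (x n) (ε n)) (hε : Tendsto ε atTop (𝓝 0))
    (hx₀ : Tendsto x₀ atTop (𝓝 π₀)) :
    ∃ z : Set.Icc (0 : ℝ) T → ℕ → ℝ, ∀ t, Tendsto (fun n => (x n t : ℕ → ℝ)) atTop (𝓝 (z t)) := by
  have herror : Tendsto (fun n : ℕ × ℕ => (ε n.1 + ε n.2 + dist (x₀ n.1) (x₀ n.2)) *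
      growthConst L k lam T) atTop (𝓝 0) := by
    have hfst : Tendsto (Prod.fst : ℕ × ℕ → ℕ) atTop atTop := by
      rw [← prod_atTop_atTop_eq]
      exact tendsto_fst
    have hsnd : Tendsto (Prod.snd : ℕ × ℕ → ℕ) atTop atTop := by
      rw [← prod_atTop_atTop_eq]
      exact tendsto_snd
    simpa using (((hε.comp hfst).add (hε.comp hsnd)).add
      ((hx₀.comp hfst).dist (hx₀.comp hsnd))).mul_const (growthConst L k lam T)
  have hcauchy : ∀ t j, CauchySeq fun n => x n t j := fun t j => by
    refine cauchySeq_iff_tendsto_dist_atTop_0.2 (squeeze_zero (fun _ => dist_nonneg) (fun n => ?_)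
      (by simpa using herror.const_mul (2 ^ j)))
    refine ((x n.1 t).abs_sub_le_dist (x n.2 t) j).trans ?_
    gcongr
    exact (hx n.1).dist_le hlam (hx n.2) t
  choose z hz using fun t j => cauchySeq_tendsto_of_complete (hcauchy t j)
  exact ⟨z, fun t => tendsto_pi_nhds.2 (hz t)⟩

theorem isCoordSolution_of_tendsto (hlam : 0 ≤ lam)
    (hx : ∀ n, IsApproxSolution L k lam hT (x₀ n) (x n) (ε n)) (hε : Tendsto ε atTop (𝓝 0))
    (hx₀ : Tendsto x₀ atTop (𝓝 π₀)) {z : Set.Icc (0 : ℝ) T → ℕ → ℝ}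
    (hz : ∀ t, Tendsto (fun n => (x n t : ℕ → ℝ)) atTop (𝓝 (z t))) :
    IsCoordSolution L k lam hT π₀ z := by
  intro t j
  have hdefect : Tendsto (fun n => defect L k lam hT (x₀ n) (x n) t j) atTop (𝓝 0) :=
    squeeze_zero_norm (fun n => (hx n).abs_defect_le t j) (by simpa using hε.mul_const (2 ^ j))
  have hintegral : Tendsto
      (fun n => timeIntegral hT (fun s => netInflow (flux L k lam (x n s)) j) t) atTop
      (𝓝 (timeIntegral hT (fun s => netInflow (flux L k lam (z s)) j) t)) :=
    intervalIntegral.tendsto_integral_filter_of_dominated_convergence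
      (fun _ => driftBound L k lam)
      (Eventually.of_forall fun n => (measurable_IccExtend hT
        (rightCts_netInflow_flux L k lam (x n) j)).aestronglyMeasurable)
      (Eventually.of_forall fun n => ae_of_all _ fun s _ =>
        abs_netInflow_flux_le hlam (x n _).mem_subSimplex j)
      intervalIntegrable_const
      (ae_of_all _ fun s _ => ((continuous_netInflow_flux L k lam j).tendsto _).comp (hz _))
  have hlim := ((tendsto_pi_nhds.1 (hz t) j).sub
    (tendsto_pi_nhds.1 (Simplex.tendsto_iff.1 hx₀) j)).sub hintegral
  linarith [tendsto_nhds_unique hlim hdefect]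

end Approximation

section MassConservation
variable {π₀ : Simplex} {z : Set.Icc (0 : ℝ) T → ℕ → ℝ}

theorem intervalIntegrable_netInflow_flux (hlam : 0 ≤ lam)
    (hmeas : Measurable (Set.IccExtend hT z)) (hmem : ∀ t, z t ∈ subSimplex) (j : ℕ) (a b : ℝ) :
    IntervalIntegrable (Set.IccExtend hT fun s => netInflow (flux L k lam (z s)) j) volume a b :=
  (intervalIntegrable_const (c := driftBound L k lam)).mono_fun
    ((continuous_netInflow_flux L k lam j).measurable.comp hmeas).aestronglyMeasurable
    (ae_of_all _ fun _ => (abs_netInflow_flux_le hlam (hmem _) j).trans (le_abs_self _))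

theorem IsCoordSolution.sum_range_succ (hlam : 0 ≤ lam) (hz : IsCoordSolution L k lam hT π₀ z)
    (hmeas : Measurable (Set.IccExtend hT z)) (hmem : ∀ t, z t ∈ subSimplex)
    (t : Set.Icc (0 : ℝ) T) (J : ℕ) :
    ∑ j ∈ Finset.range (J + 1), z t j =
      ∑ j ∈ Finset.range (J + 1), π₀ j - timeIntegral hT (fun s => flux L k lam (z s) J) t := by
  have hint := intervalIntegrable_netInflow_flux (k := k) (L := L) hlam hmeas hmem
  rw [Finset.sum_congr rfl fun j _ => hz t j, Finset.sum_add_distrib, sub_eq_add_neg]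
  simp only [timeIntegral]
  rw [← intervalIntegral.integral_finsetSum fun j _ => hint j 0 t,
    ← intervalIntegral.integral_neg]
  simp only [Set.IccExtend, Function.comp_apply, sum_range_succ_netInflow]

theorem tendsto_timeIntegral_flux (hlam : 0 ≤ lam) (hmeas : Measurable (Set.IccExtend hT z))
    (hmem : ∀ t, z t ∈ subSimplex) (t : Set.Icc (0 : ℝ) T) :
    Tendsto (fun J => timeIntegral hT (fun s => flux L k lam (z s) J) t) atTop (𝓝 0) := by
  have hflux : ∀ s, Tendsto (fun J => flux L k lam (z s) J) atTop (𝓝 0) := fun s => by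
    have hzero := (summable_of_sum_range_le (hmem s).1 (hmem s).2).tendsto_atTop_zero
    refine squeeze_zero_norm (fun J => abs_flux_le hlam (hmem s) J) ?_
    simpa using (hzero.const_mul _).add (((tendsto_add_atTop_iff_nat 1).2 hzero).const_mul (k : ℝ))
  have hlim : Tendsto (fun J => timeIntegral hT (fun s => flux L k lam (z s) J) t) atTop
      (𝓝 (∫ _ in (0 : ℝ)..t, (0 : ℝ))) :=
    intervalIntegral.tendsto_integral_filter_of_dominated_convergence
      (fun _ => driftBound L k lam)
      (Eventually.of_forall fun J =>
        ((continuous_flux L k lam J).measurable.comp hmeas).aestronglyMeasurable)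
      (Eventually.of_forall fun J => ae_of_all _ fun s _ =>
        abs_flux_le_driftBound hlam (hmem _) J)
      intervalIntegrable_const (ae_of_all _ fun s _ => hflux _)
  simpa using hlim

theorem IsCoordSolution.hasSum (hlam : 0 ≤ lam) (hz : IsCoordSolution L k lam hT π₀ z)
    (hmeas : Measurable (Set.IccExtend hT z)) (hmem : ∀ t, z t ∈ subSimplex)
    (t : Set.Icc (0 : ℝ) T) : HasSum (z t) 1 := by
  rw [hasSum_iff_tendsto_nat_of_nonneg (hmem t).1, ← tendsto_add_atTop_iff_nat 1]
  simp only [hz.sum_range_succ hlam hmeas hmem t]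
  simpa using ((tendsto_add_atTop_iff_nat 1).2 π₀.hasSum.tendsto_sum_nat).sub
    (tendsto_timeIntegral_flux hlam hmeas hmem t)

theorem IsCoordSolution.exists_continuousMap (hlam : 0 ≤ lam)
    (hz : IsCoordSolution L k lam hT π₀ z) (hmeas : Measurable (Set.IccExtend hT z))
    (hmem : ∀ t, z t ∈ subSimplex) :
    ∃ π : C(Set.Icc (0 : ℝ) T, Simplex), ∀ t, (π t : ℕ → ℝ) = z t := by
  have hcont : Continuous z := continuous_pi fun j => by
    rw [show (fun t => z t j) = _ from funext fun t => hz t j]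
    exact continuous_const.add (continuous_timeIntegral hT
      (intervalIntegrable_netInflow_flux hlam hmeas hmem j))
  exact ⟨⟨fun t => ⟨z t, (hmem t).1, hz.hasSum hlam hmeas hmem t⟩, continuous_iff_continuousAt.2
    fun t => Simplex.tendsto_iff.2 (hcont.tendsto t)⟩, fun _ => rfl⟩

end MassConservation

/-! ### Solutions in `ℓ₁` -/

theorem norm_drift_le (hlam : 0 ≤ lam) (s : Simplex) :
    ‖drift L k lam s.toL1‖ ≤ driftBound L k lam := by
  refine lp.norm_le_of_tsum_le (by norm_num) (driftBound_nonneg L k hlam) ?_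
  simp only [ENNReal.toReal_one, Real.rpow_one, Real.norm_eq_abs]
  refine Real.tsum_le_of_sum_range_le (fun _ => abs_nonneg _) fun J => ?_
  simp only [drift, Simplex.toL1, Simplex.driftCoord_eq]
  exact sum_abs_netInflow_flux_le hlam s.mem_subSimplex J

theorem stronglyMeasurable_IccExtend_drift (L k : ℕ) (lam : ℝ) (hT : 0 ≤ T)
    (π : C(Set.Icc (0 : ℝ) T, Simplex)) :
    StronglyMeasurable (Set.IccExtend hT fun s => drift L k lam (π s).toL1) := by
  have hcoord : ∀ j, Continuous (Set.IccExtend hT fun s => driftCoord L k lam (π s) j) :=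
    fun j => by
    simp only [Simplex.driftCoord_eq]
    exact ((continuous_netInflow_flux L k lam j).comp
      (Simplex.continuous_coe.comp π.continuous)).Icc_extend'
  refine stronglyMeasurable_of_tendsto atTop (f := fun (J : ℕ) s => ∑ j ∈ Finset.range J,
    lp.single 1 j (Set.IccExtend hT (fun s => driftCoord L k lam (π s) j) s) (E := fun _ => ℝ))
    (fun J => Finset.stronglyMeasurable_fun_sum _ fun j _ => ?_) (tendsto_pi_nhds.2 fun s => ?_)
  · exact ((lp.singleContinuousLinearMap ℝ (fun _ : ℕ => ℝ) 1 j).continuous.comp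
      (hcoord j)).stronglyMeasurable
  · exact (lp.hasSum_single (by norm_num) (drift L k lam (π _).toL1)).tendsto_sum_nat

theorem intervalIntegrable_IccExtend_drift (hlam : 0 ≤ lam) (hT : 0 ≤ T)
    (π : C(Set.Icc (0 : ℝ) T, Simplex)) (a b : ℝ) :
    IntervalIntegrable (Set.IccExtend hT fun s => drift L k lam (π s).toL1) volume a b :=
  (intervalIntegrable_const (c := driftBound L k lam)).mono_fun
    (stronglyMeasurable_IccExtend_drift L k lam hT π).aestronglyMeasurable
    (ae_of_all _ fun _ => (norm_drift_le hlam _).trans (le_abs_self _))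

theorem isSolution_iff (hlam : 0 ≤ lam) {π₀ : Simplex} {π : C(Set.Icc (0 : ℝ) T, Simplex)} :
    IsSolution L k lam hT π₀ π ↔ IsCoordSolution L k lam hT π₀ fun t => π t := by
  have hint := intervalIntegrable_IccExtend_drift (L := L) (k := k) hlam hT π
  have hcoord : ∀ (t : Set.Icc (0 : ℝ) T) (j : ℕ),
      (∫ s in (0 : ℝ)..t, Set.IccExtend hT (fun s => drift L k lam (π s).toL1) s : L1) j =
        timeIntegral hT (fun s => netInflow (flux L k lam (π s)) j) t := fun t j => by
    simp only [← Simplex.driftCoord_eq]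
    exact ((lp.evalCLM ℝ (fun _ : ℕ => ℝ) (p := 1) j).intervalIntegral_comp_comm (hint 0 t)).symm
  have hext : ∀ u v : L1, u = v ↔ ∀ j, u j = v j := fun u v => by rw [lp.ext_iff, funext_iff]
  simp only [IsSolution, hint, true_and, hext, lp.coeFn_add, Pi.add_apply, hcoord]
  rfl

theorem exists_isSolution_of_isApproxSolution (hlam : 0 ≤ lam) {π₀ : Simplex} {x₀ : ℕ → Simplex}
    {x : ℕ → Cadlag T Simplex} {ε : ℕ → ℝ}
    (hx : ∀ n, IsApproxSolution L k lam hT (x₀ n) (x n) (ε n)) (hε : Tendsto ε atTop (𝓝 0))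
    (hx₀ : Tendsto x₀ atTop (𝓝 π₀)) :
    ∃ π : C(Set.Icc (0 : ℝ) T, Simplex), IsSolution L k lam hT π₀ π := by
  obtain ⟨z, hxz⟩ := exists_tendsto_of_isApproxSolution hlam hx hε hx₀
  have hz := isCoordSolution_of_tendsto hlam hx hε hx₀ hxz
  have hmem : ∀ t, z t ∈ subSimplex := fun t =>
    isClosed_subSimplex.mem_of_tendsto (hxz t)
      (Eventually.of_forall fun n => (x n t).mem_subSimplex)
  have hmeas : Measurable (Set.IccExtend hT z) := measurable_of_tendsto_metrizable
    (fun n => measurable_IccExtend hT fun t =>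
      Simplex.continuous_coe.continuousAt.comp_continuousWithinAt ((x n).rightCts t))
    (tendsto_pi_nhds.2 fun s => hxz _)
  obtain ⟨π, hπ⟩ := hz.exists_continuousMap hlam hmeas hmem
  refine ⟨π, (isSolution_iff hlam).2 ?_⟩
  rwa [funext hπ]

theorem IsSolution.isApproxSolution (hlam : 0 ≤ lam) {π₀ : Simplex}
    {π : C(Set.Icc (0 : ℝ) T, Simplex)} (hπ : IsSolution L k lam hT π₀ π) :
    IsApproxSolution L k lam hT π₀ (Cadlag.ofContinuous π) 0 := fun t J => by
  refine (Finset.sum_eq_zero fun j _ => ?_).le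
  have hdefect : defect L k lam hT π₀ (Cadlag.ofContinuous π) t j = 0 := by
    have h := (isSolution_iff hlam).1 hπ t j
    rw [← sub_eq_zero, ← sub_sub] at h
    exact h
  simp [hdefect]

theorem IsSolution.unique (hlam : 0 ≤ lam) {π₀ : Simplex} {π π' : C(Set.Icc (0 : ℝ) T, Simplex)}
    (hπ : IsSolution L k lam hT π₀ π) (hπ' : IsSolution L k lam hT π₀ π') : π = π' :=
  ContinuousMap.ext fun t => dist_le_zero.1 <| by
    simpa [Cadlag.ofContinuous] using
      (hπ.isApproxSolution hlam).dist_le hlam (hπ'.isApproxSolution hlam) t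

end

/-! ### Jump rates and the quadratic variation of the empirical measure -/

section
variable {n L c k : ℕ} {lam : ℝ} {S : Storage n L c} {R : Routing n L k}

/-- The sum over the transitions out of `q` of rate times value, where an arrival to `B` has the
value `u B` and a departure from `j` has the value `v j`. -/
def rateSum (k : ℕ) (lam : ℝ) (S : Storage n L c) (R : Routing n L k) (q : Fin n → ℕ)
    (u : Finset (Fin n) → ℝ) (v : Fin n → ℝ) : ℝ :=
  n * lam * (1 / (S.numFiles : ℝ) * ∑ i, ∑ B, R.prob q (S.servers i) B * u B) +
    ∑ j, if 0 < q j then (k : ℝ) * v j else 0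

theorem generator_eq_rateSum (f : (Fin n → ℕ) → ℝ) (q : Fin n → ℕ) :
    generator k lam S R f q =
      rateSum k lam S R q (fun B => f (arrive q B) - f q) (fun j => f (depart q j) - f q) :=
  rfl

theorem rateSum_add_const_mul (q : Fin n → ℕ) (a : ℝ) (u u' : Finset (Fin n) → ℝ)
    (v v' : Fin n → ℝ) :
    rateSum k lam S R q (fun B => u B + a * u' B) (fun j => v j + a * v' j) =
      rateSum k lam S R q u v + a * rateSum k lam S R q u' v' := by
  have hdepart : ∀ j, (if 0 < q j then (k : ℝ) * (v j + a * v' j) else 0) =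
      (if 0 < q j then (k : ℝ) * v j else 0) + a * if 0 < q j then (k : ℝ) * v' j else 0 :=
    fun j => by split_ifs <;> ring
  simp only [rateSum, hdepart]
  simp only [mul_add, mul_left_comm _ a, Finset.sum_add_distrib, ← Finset.mul_sum]
  ring

theorem generator_sq_sub (f : (Fin n → ℕ) → ℝ) (q : Fin n → ℕ) :
    generator k lam S R (fun q => f q ^ 2) q - 2 * f q * generator k lam S R f q =
      rateSum k lam S R q (fun B => (f (arrive q B) - f q) ^ 2)
        (fun j => (f (depart q j) - f q) ^ 2) := by
  have hsq : ∀ x y : ℝ, x ^ 2 - y ^ 2 = (x - y) ^ 2 + 2 * y * (x - y) := fun x y => by ring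
  simp only [generator_eq_rateSum, hsq, rateSum_add_const_mul, add_sub_cancel_right]

theorem Routing.abs_sum_prob_mul_le (R : Routing n L k) (q : Fin n → ℕ) {A : Finset (Fin n)}
    (hA : A.card = L) {u : Finset (Fin n) → ℝ} {a : ℝ} (hu : ∀ B, B.card = k → |u B| ≤ a) :
    |∑ B, R.prob q A B * u B| ≤ a :=
  calc |∑ B, R.prob q A B * u B| ≤ ∑ B, |R.prob q A B * u B| := Finset.abs_sum_le_sum_abs _ _
    _ ≤ ∑ B, R.prob q A B * a := Finset.sum_le_sum fun B _ => by
        rw [abs_mul, abs_of_nonneg (R.nonneg _ _ _)]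
        by_cases hB : R.prob q A B = 0
        · rw [hB, zero_mul, zero_mul]
        · exact mul_le_mul_of_nonneg_left (hu B (R.shortest _ _ _ hA hB).2.1) (R.nonneg _ _ _)
    _ = a := by rw [← Finset.sum_mul, R.sum_eq_one _ _ hA, one_mul]

theorem abs_rateSum_le (hlam : 0 ≤ lam) (q : Fin n → ℕ) {u : Finset (Fin n) → ℝ}
    {v : Fin n → ℝ} {a b : ℝ} (ha : 0 ≤ a) (hb : 0 ≤ b) (hu : ∀ B, B.card = k → |u B| ≤ a)
    (hv : ∀ j, |v j| ≤ b) : |rateSum k lam S R q u v| ≤ n * (lam * a + k * b) := by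
  have harrive : |1 / (S.numFiles : ℝ) * ∑ i, ∑ B, R.prob q (S.servers i) B * u B| ≤ a := by
    rw [one_div_mul_eq_div, abs_div, Nat.abs_cast]
    refine div_le_of_le_mul₀ (Nat.cast_nonneg _) ha ((Finset.abs_sum_le_sum_abs _ _).trans ?_)
    refine (Finset.sum_le_card_nsmul _ _ a fun i _ =>
      R.abs_sum_prob_mul_le q (S.card_servers i) hu).trans_eq ?_
    simp [mul_comm]
  have hdepart : |∑ j, if 0 < q j then (k : ℝ) * v j else 0| ≤ n * (k * b) := by
    refine (Finset.abs_sum_le_sum_abs _ _).trans ((Finset.sum_le_card_nsmul _ _ (k * b)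
      fun j _ => ?_).trans_eq (by simp))
    split_ifs
    · rw [abs_mul, Nat.abs_cast]
      exact mul_le_mul_of_nonneg_left (hv j) k.cast_nonneg
    · rw [abs_zero]
      positivity
  rw [mul_add, ← mul_assoc]
  refine (abs_add_le _ _).trans (add_le_add ?_ hdepart)
  rw [abs_mul, abs_of_nonneg (by positivity)]
  gcongr

theorem exists_abs_generator_le (hlam : 0 ≤ lam) {f : (Fin n → ℕ) → ℝ}
    (hf : ∃ C, ∀ q, |f q| ≤ C) : ∃ C, ∀ q, |generator k lam S R f q| ≤ C := by
  obtain ⟨C, hC⟩ := hf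
  have hsub : ∀ q q', |f q' - f q| ≤ C + C := fun q q' =>
    (abs_sub _ _).trans (add_le_add (hC _) (hC _))
  exact ⟨n * (lam * (C + C) + k * (C + C)), fun q => abs_rateSum_le hlam q
    ((abs_nonneg _).trans (hsub q q)) ((abs_nonneg _).trans (hsub q q)) (fun _ _ => hsub _ _)
    fun _ => hsub _ _⟩

theorem abs_empirical_arrive_sub_le (hn : 0 < n) (q : Fin n → ℕ) (B : Finset (Fin n)) (j : ℕ) :
    |empirical (arrive q B) j - empirical q j| ≤ 2 * B.card / n := by
  rw [empirical_arrive_sub hn, one_div_mul_eq_div, abs_div, Nat.abs_cast]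
  gcongr
  refine abs_netInflow_le (fun i => ?_) j
  rw [Nat.abs_cast]
  exact_mod_cast B.card_filter_le _

theorem abs_empirical_depart_sub_le (hn : 0 < n) (q : Fin n → ℕ) (i : Fin n) (j : ℕ) :
    |empirical (depart q i) j - empirical q j| ≤ 1 / n := by
  rw [empirical_depart_sub hn, abs_mul, abs_of_nonneg (by positivity)]
  refine mul_le_of_le_one_right (by positivity) ?_
  split_ifs <;> simp

/-- `quadVarConst k lam / n` bounds the growth rate of the quadratic variation of a coordinate of
the empirical measure. -/
def quadVarConst (k : ℕ) (lam : ℝ) : ℝ := lam * (2 * k) ^ 2 + k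

theorem generator_sq_sub_empirical_le (hn : 0 < n) (hlam : 0 ≤ lam) (j : ℕ) (q : Fin n → ℕ) :
    generator k lam S R (fun q => empirical q j ^ 2) q -
      2 * empirical q j * generator k lam S R (fun q => empirical q j) q ≤
        quadVarConst k lam / n := by
  rw [generator_sq_sub fun q => empirical q j]
  refine (le_abs_self _).trans ((abs_rateSum_le hlam q (a := (2 * k / n) ^ 2) (b := (1 / n) ^ 2)
    (by positivity) (by positivity) (fun B hB => ?_) fun i => ?_).trans_eq ?_)
  · rw [abs_pow, ← hB]
    gcongr
    exact abs_empirical_arrive_sub_le hn q B j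
  · rw [abs_pow]
    gcongr
    exact abs_empirical_depart_sub_le hn q i j
  · unfold quadVarConst
    field_simp

end

/-! ### The empirical measure is an approximate solution -/

theorem IsApproxSolution.mono {L k : ℕ} {lam T : ℝ} {hT : 0 ≤ T} {x₀ : Simplex}
    {x : Cadlag T Simplex} {ε ε' : ℝ} (hx : IsApproxSolution L k lam hT x₀ x ε) (hε : ε ≤ ε') :
    IsApproxSolution L k lam hT x₀ x ε' :=
  fun t J => (hx t J).trans hε

theorem sum_div_two_pow_le {e : ℕ → ℝ} {δ a : ℝ} (hδ : 0 ≤ δ) (ha : 0 ≤ a)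
    (he : ∀ j, e j ≤ δ * (3 / 2) ^ j + a) (J : ℕ) :
    ∑ j ∈ Finset.range J, e j / 2 ^ j ≤ 4 * δ + 2 * a := by
  have hgeom : ∀ r : ℝ, 0 ≤ r → r < 1 → ∑ j ∈ Finset.range J, r ^ j ≤ 1 / (1 - r) :=
    fun r h0 h1 => by simpa using geom_sum_Ico_le_of_lt_one (m := 0) (n := J) h0 h1
  calc ∑ j ∈ Finset.range J, e j / 2 ^ j
      ≤ ∑ j ∈ Finset.range J, (δ * (3 / 4) ^ j + a * (1 / 2) ^ j) := by
        refine Finset.sum_le_sum fun j _ => ?_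
        rw [div_le_iff₀ (by positivity), add_mul, mul_assoc, mul_assoc, ← mul_pow, ← mul_pow]
        norm_num
        exact he j
    _ = δ * ∑ j ∈ Finset.range J, (3 / 4) ^ j + a * ∑ j ∈ Finset.range J, (1 / 2) ^ j := by
        rw [Finset.sum_add_distrib, Finset.mul_sum, Finset.mul_sum]
    _ ≤ δ * (1 / (1 - 3 / 4)) + a * (1 / (1 - 1 / 2)) := by
        gcongr
        exacts [hgeom _ (by norm_num) (by norm_num), hgeom _ (by norm_num) (by norm_num)]
    _ = 4 * δ + 2 * a := by ring

theorem exists_abs_empirical_le (n j : ℕ) : ∃ C, ∀ q : Fin n → ℕ, |empirical q j| ≤ C :=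
  ⟨1, fun q => (abs_of_nonneg ((empirical q).mem_Icc j).1).trans_le ((empirical q).mem_Icc j).2⟩

/-- The martingale part of the `j`-th coordinate of the empirical measure, along the path `x` of
queue lengths started from `q`. -/
def martingalePart {n L c : ℕ} (k : ℕ) (lam : ℝ) {T : ℝ} (hT : 0 ≤ T) (S : Storage n L c)
    (R : Routing n L k) (q : Fin n → ℕ) (x : Cadlag T (Fin n → ℕ)) (t : Set.Icc (0 : ℝ) T)
    (j : ℕ) : ℝ :=
  empirical (x t) j -
    timeIntegral hT (fun s => generator k lam S R (fun q => empirical q j) (x s)) t - empirical q j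

theorem abs_defect_empiricalPath_le {n L c k : ℕ} (hc : 1 ≤ c) (hn : L ≤ n) (hn0 : 0 < n)
    {lam T : ℝ} (hlam : 0 ≤ lam) (hT : 0 ≤ T) (S : Storage n L c) (R : Routing n L k)
    (q : Fin n → ℕ) (x : Cadlag T (Fin n → ℕ)) (t : Set.Icc (0 : ℝ) T) (j : ℕ) :
    |defect L k lam hT (empirical q) (empiricalPath x) t j| ≤
      |martingalePart k lam hT S R q x t j| + 2 * (lam * (samplingConst L k / n)) * T := by
  let G : (Fin n → ℕ) → ℝ := generator k lam S R fun q => empirical q j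
  let F : (Fin n → ℕ) → ℝ := fun q => netInflow (flux L k lam (empirical q)) j
  have herr : ∀ q, |G q - F q| ≤ 2 * (lam * (samplingConst L k / n)) := fun q =>
    abs_generator_empirical_sub_le hc hn hn0 hlam S R q j
  have hint : ∀ {f : (Fin n → ℕ) → ℝ} {C : ℝ}, (∀ q, |f q| ≤ C) →
      IntervalIntegrable (Set.IccExtend hT fun s => f (x s)) volume 0 t := fun hC =>
    intervalIntegrable_IccExtend hT (fun s =>
      continuous_of_discreteTopology.continuousAt.comp_continuousWithinAt (x.rightCts s))
      (fun s => hC (x s)) 0 t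
  obtain ⟨C, hC⟩ := exists_abs_generator_le (S := S) (R := R) hlam (exists_abs_empirical_le n j)
  have hdrift : |timeIntegral hT (fun s => G (x s)) t - timeIntegral hT (fun s => F (x s)) t| ≤
      2 * (lam * (samplingConst L k / n)) * T := by
    rw [timeIntegral, timeIntegral, ← intervalIntegral.integral_sub (hint hC)
      (hint fun q => abs_netInflow_flux_le hlam (empirical q).mem_subSimplex j)]
    exact (norm_timeIntegral_le hT (x := fun s => G (x s) - F (x s)) (fun s => herr (x s)) t).trans
      (mul_le_mul_of_nonneg_left t.2.2 ((abs_nonneg _).trans (herr q)))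
  have hsplit : defect L k lam hT (empirical q) (empiricalPath x) t j =
      martingalePart k lam hT S R q x t j +
        (timeIntegral hT (fun s => G (x s)) t - timeIntegral hT (fun s => F (x s)) t) := by
    have h : defect L k lam hT (empirical q) (empiricalPath x) t j =
      empirical (x t) j - empirical q j - timeIntegral hT (fun s => F (x s)) t := rfl
    rw [h, martingalePart]
    ring
  rw [hsplit]
  exact (abs_add_le _ _).trans (by gcongr)

theorem isApproxSolution_empiricalPath {n L c k : ℕ} (hc : 1 ≤ c) (hn : L ≤ n) (hn0 : 0 < n)
    {lam T : ℝ} (hlam : 0 ≤ lam) {hT : 0 ≤ T} (S : Storage n L c) (R : Routing n L k)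
    {q : Fin n → ℕ} {x : Cadlag T (Fin n → ℕ)} {δ : ℝ} (hδ : 0 ≤ δ)
    (hx : ∀ t j, |martingalePart k lam hT S R q x t j| ≤ δ * (3 / 2) ^ j) :
    IsApproxSolution L k lam hT (empirical q) (empiricalPath x)
      (4 * δ + 2 * (2 * (lam * (samplingConst L k / n)) * T)) := by
  have hsampling : 0 ≤ 2 * (lam * (samplingConst L k / n)) :=
    (abs_nonneg _).trans (abs_generator_empirical_sub_le hc hn hn0 hlam S R q 0)
  refine fun t => sum_div_two_pow_le hδ (mul_nonneg hsampling hT) fun j => ?_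
  exact (abs_defect_empiricalPath_le hc hn hn0 hlam hT S R q x t j).trans (by gcongr; exact hx t j)

namespace IsQueueProcess

variable {n L c k : ℕ} {lam T : ℝ} {hT : 0 ≤ T} {S : Storage n L c} {R : Routing n L k}
  {Ω : Type*} {mΩ : MeasurableSpace Ω} {P : Measure Ω} {ℱ : Filtration (Set.Icc (0 : ℝ) T) mΩ}
  {q : Fin n → ℕ} {Q : Ω → Cadlag T (Fin n → ℕ)}

theorem isBddRightCts (hQ : IsQueueProcess k lam hT S R P ℱ q Q) {f : (Fin n → ℕ) → ℝ}
    (hf : ∃ C, ∀ q, |f q| ≤ C) : IsBddRightCts ℱ fun t ω => f (Q ω t) where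
  measurable t := (Measurable.of_discrete (f := f)).comp (hQ.adapted t)
  rightCts ω t := (continuous_of_discreteTopology (f := f)).continuousAt.comp_continuousWithinAt
    ((Q ω).rightCts t)
  bounded := hf.imp fun _ hC _ _ => hC _

variable [IsProbabilityMeasure P]

theorem measure_exists_lt_abs_martingalePart_le (hn : 0 < n) (hlam : 0 ≤ lam)
    (hQ : IsQueueProcess k lam hT S R P ℱ q Q) (j : ℕ) {δ : ℝ} (hδ : 0 < δ) :
    P {ω | ∃ t, δ < |martingalePart k lam hT S R q (Q ω) t j|} ≤
      ENNReal.ofReal (quadVarConst k lam / n * T / δ ^ 2) := by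
  have hf := exists_abs_empirical_le n j
  have hf2 : ∃ C, ∀ q : Fin n → ℕ, |empirical q j ^ 2| ≤ C := hf.imp' (· ^ 2) fun C hC q => by
    rw [abs_pow]
    exact pow_le_pow_left₀ (abs_nonneg _) (hC q) 2
  refine measure_exists_lt_abs_compensated_sub_le (hQ.isBddRightCts hf)
    (hQ.isBddRightCts (exists_abs_generator_le hlam hf))
    (hQ.isBddRightCts (exists_abs_generator_le hlam hf2)) (hQ.martingale _ hf)
    (hQ.martingale _ hf2) (fun t ω => generator_sq_sub_empirical_le hn hlam j (Q ω t)) ?_ hδ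
  filter_upwards [hQ.initial] with ω hω
  rw [hω]

theorem measure_not_isApproxSolution_le (hc : 1 ≤ c) (hn : L ≤ n) (hn0 : 0 < n) (hlam : 0 ≤ lam)
    (hQ : IsQueueProcess k lam hT S R P ℱ q Q) {δ : ℝ} (hδ : 0 < δ) :
    P {ω | ¬ IsApproxSolution L k lam hT (empirical q) (empiricalPath (Q ω))
        (4 * δ + 2 * (2 * (lam * (samplingConst L k / n)) * T))} ≤
      ENNReal.ofReal (quadVarConst k lam / n * T / δ ^ 2 * (9 / 5)) := by
  let γ : ℝ := quadVarConst k lam / n * T / δ ^ 2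
  have hγ : 0 ≤ γ := by
    unfold γ quadVarConst
    positivity
  let bad : ℕ → Set Ω := fun j =>
    {ω | ∃ t, δ * (3 / 2) ^ j < |martingalePart k lam hT S R q (Q ω) t j|}
  have hbad : ∀ j, P (bad j) ≤ ENNReal.ofReal (γ * (4 / 9) ^ j) := fun j => by
    have hpow : ((3 / 2 : ℝ) ^ j) ^ 2 = ((4 / 9) ^ j)⁻¹ := by
      rw [pow_right_comm, ← inv_pow]
      norm_num
    refine (hQ.measure_exists_lt_abs_martingalePart_le hn0 hlam j
      (by positivity : 0 < δ * (3 / 2) ^ j)).trans_eq (congrArg _ ?_)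
    rw [mul_pow, hpow, ← div_div, div_inv_eq_mul]
  have hsum : HasSum (fun j : ℕ => γ * (4 / 9 : ℝ) ^ j) (γ * (9 / 5)) := by
    have h := hasSum_geometric_of_lt_one (r := (4 / 9 : ℝ)) (by norm_num) (by norm_num)
    norm_num at h
    exact h.mul_left γ
  calc P _ ≤ P (⋃ j, bad j) := by
        refine measure_mono fun ω hω => ?_
        by_contra hgood
        simp only [bad, Set.mem_iUnion, Set.mem_ofPred_eq, not_exists, not_lt] at hgood
        exact hω (isApproxSolution_empiricalPath hc hn hn0 hlam S R hδ.le fun t j => hgood j t)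
    _ ≤ ∑' j, P (bad j) := measure_iUnion_le _
    _ ≤ ∑' j : ℕ, ENNReal.ofReal (γ * (4 / 9) ^ j) := ENNReal.tsum_le_tsum hbad
    _ = ENNReal.ofReal (γ * (9 / 5)) := by
        rw [← ENNReal.ofReal_tsum_of_nonneg (fun j => by positivity) hsum.summable, hsum.tsum_eq]

end IsQueueProcess

/-! ### The law of large numbers -/

theorem skorohodEDist_ofContinuous_le {T : ℝ} {E : Type*} [MetricSpace E] {x : Cadlag T E}
    {y : C(Set.Icc (0 : ℝ) T, E)} {a : ℝ} (h : ∀ t, dist (x t) (y t) ≤ a) :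
    skorohodEDist x (Cadlag.ofContinuous y) ≤ ENNReal.ofReal a := by
  refine (iInf_le _ (OrderIso.refl _)).trans (max_le (by simp) (iSup_le fun t => ?_))
  rw [edist_dist]
  exact ENNReal.ofReal_le_ofReal (h t)

section

variable {L k c : ℕ} {lam T : ℝ} {hT : 0 ≤ T} {S : ∀ n, Storage n L c} {R : ∀ n, Routing n L k}
  {Ω : ℕ → Type*} {mΩ : ∀ n, MeasurableSpace (Ω n)} {P : ∀ n, Measure (Ω n)}
  {q : ∀ n, Fin n → ℕ} {Q : ∀ n, Ω n → Cadlag T (Fin n → ℕ)}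
  {π₀ : Simplex}

theorem IsSolution.tendsto_measure_le_skorohodEDist (hlam : 0 ≤ lam)
    {π : C(Set.Icc (0 : ℝ) T, Simplex)} (hπ : IsSolution L k lam hT π₀ π)
    (happrox : ∀ η > 0, Tendsto (fun n => P n {ω | ¬ IsApproxSolution L k lam hT (empirical (q n))
      (empiricalPath (Q n ω)) η}) atTop (𝓝 0))
    (hπ₀ : Tendsto (fun n => empirical (q n)) atTop (𝓝 π₀)) {ε : ℝ≥0∞} (hε : 0 < ε) :
    Tendsto (fun n => P n {ω | ε ≤ skorohodEDist (empiricalPath (Q n ω))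
      (Cadlag.ofContinuous π)}) atTop (𝓝 0) := by
  obtain ⟨e, he0, he⟩ := ENNReal.lt_iff_exists_nnreal_btwn.1 hε
  have he0' : (0 : ℝ) < e := by exact_mod_cast he0
  have hG : 0 < growthConst L k lam T := Real.exp_pos _
  let η : ℝ := e / (2 * growthConst L k lam T)
  have hη : 0 < η := by positivity
  have hηe : (η + 0 + η) * growthConst L k lam T = e := by
    unfold η
    field_simp
    ring
  refine tendsto_of_tendsto_of_tendsto_of_le_of_le' tendsto_const_nhds (happrox η hη)
    (Eventually.of_forall fun _ => zero_le) ?_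
  filter_upwards [(tendsto_iff_dist_tendsto_zero.1 hπ₀).eventually_le_const hη] with n hn
  refine measure_mono fun ω (hω : ε ≤ _) hx => (hω.trans ?_).not_gt he
  have hdist : ∀ t, dist (empiricalPath (Q n ω) t) (π t) ≤ e := fun t =>
    (hx.dist_le hlam (hπ.isApproxSolution hlam) t).trans (by rw [← hηe]; gcongr)
  simpa using skorohodEDist_ofContinuous_le hdist

variable [∀ n, IsProbabilityMeasure (P n)]

theorem tendsto_measure_not_isApproxSolution (hc : 1 ≤ c) (hlam : 0 ≤ lam)
    {ℱ : ∀ n, Filtration (Set.Icc (0 : ℝ) T) (mΩ n)}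
    (hQ : ∀ n, L ≤ n → IsQueueProcess k lam hT (S n) (R n) (P n) (ℱ n) (q n) (Q n))
    {η : ℝ} (hη : 0 < η) :
    Tendsto (fun n => P n {ω | ¬ IsApproxSolution L k lam hT (empirical (q n))
      (empiricalPath (Q n ω)) η}) atTop (𝓝 0) := by
  have hmeasure : Tendsto (fun n : ℕ => ENNReal.ofReal
      (quadVarConst k lam / n * T / (η / 8) ^ 2 * (9 / 5))) atTop (𝓝 0) := by
    rw [← ENNReal.ofReal_zero]
    refine ENNReal.tendsto_ofReal ?_
    simpa using (((tendsto_const_div_atTop_nhds_zero_nat (quadVarConst k lam)).mul_const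
      T).div_const ((η / 8) ^ 2)).mul_const (9 / 5)
  have hsampling : Tendsto (fun n : ℕ => 2 * (2 * (lam * (samplingConst L k / n)) * T))
      atTop (𝓝 0) := by
    simpa using ((((tendsto_const_div_atTop_nhds_zero_nat (samplingConst L k)).const_mul
      lam).const_mul 2).mul_const T).const_mul 2
  refine tendsto_of_tendsto_of_tendsto_of_le_of_le' tendsto_const_nhds hmeasure
    (Eventually.of_forall fun _ => zero_le) ?_
  filter_upwards [eventually_ge_atTop L, eventually_gt_atTop 0,
    hsampling.eventually_le_const (half_pos hη)] with n hn hn0 herr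
  refine (measure_mono ?_).trans
    ((hQ n hn).measure_not_isApproxSolution_le hc hn hn0 hlam (by positivity : 0 < η / 8))
  exact Set.ofPred_subset_ofPred.2 fun ω hω hω' => hω (hω'.mono (by linarith))

theorem exists_isSolution_of_tendsto_measure (hlam : 0 ≤ lam)
    (happrox : ∀ η > 0, Tendsto (fun n => P n {ω | ¬ IsApproxSolution L k lam hT (empirical (q n))
      (empiricalPath (Q n ω)) η}) atTop (𝓝 0))
    (hπ₀ : Tendsto (fun n => empirical (q n)) atTop (𝓝 π₀)) :
    ∃ π, IsSolution L k lam hT π₀ π := by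
  have hpath : ∀ m : ℕ, ∃ n ≥ m, ∃ ω, IsApproxSolution L k lam hT (empirical (q n))
      (empiricalPath (Q n ω)) (1 / ((m : ℝ) + 1)) := fun m => by
    obtain ⟨n, hn, hlt⟩ := ((eventually_ge_atTop m).and
      ((happrox (1 / ((m : ℝ) + 1)) (by positivity)).eventually_lt_const zero_lt_one)).exists
    refine ⟨n, hn, ?_⟩
    by_contra! hno
    simp only [hno, not_false_eq_true, Set.ofPred_true, measure_univ, lt_irrefl] at hlt
  choose n hn ω hω using hpath
  exact exists_isSolution_of_isApproxSolution hlam hω tendsto_one_div_add_atTop_nhds_zero_nat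
    (hπ₀.comp (tendsto_atTop_mono hn tendsto_id))

end

end BatchMDS

end

theorem theorem2p2 (L k c : ℕ) (hk : 1 ≤ k) (hkL : k ≤ L) (hc : 1 ≤ c)
    (lam : ℝ) (hlam : 0 < lam) (T : ℝ) (hT : 0 ≤ T)
    (S : ∀ n, Storage n L c) (R : ∀ n, Routing n L k)
    (Ω : ℕ → Type*) [mΩ : ∀ n, MeasurableSpace (Ω n)]
    (P : ∀ n, Measure (Ω n)) [∀ n, IsProbabilityMeasure (P n)]
    (ℱ : ∀ n, Filtration (Set.Icc (0 : ℝ) T) (mΩ n))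
    (q : ∀ n, Fin n → ℕ) (Q : ∀ n, Ω n → Cadlag T (Fin n → ℕ))
    (hQ : ∀ n, L ≤ n → IsQueueProcess k lam hT (S n) (R n) (P n) (ℱ n) (q n) (Q n))
    (π₀ : Simplex) (hπ₀ : Tendsto (fun n => empirical (q n)) atTop (𝓝 π₀)) :
    ∃ π : C(Set.Icc (0 : ℝ) T, Simplex),
      IsSolution L k lam hT π₀ π ∧
      (∀ π' : C(Set.Icc (0 : ℝ) T, Simplex), IsSolution L k lam hT π₀ π' → π' = π) ∧
      ∀ ε : ℝ≥0∞, 0 < ε →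
        Tendsto (fun n => P n {ω | ε ≤ skorohodEDist (empiricalPath (Q n ω))
          (Cadlag.ofContinuous π)}) atTop (𝓝 0) := by
  have happrox : ∀ η > 0, Tendsto (fun n => P n {ω | ¬ IsApproxSolution L k lam hT
      (empirical (q n)) (empiricalPath (Q n ω)) η}) atTop (𝓝 0) :=
    fun _ => tendsto_measure_not_isApproxSolution hc hlam.le hQ
  obtain ⟨π, hπ⟩ := exists_isSolution_of_tendsto_measure hlam.le happrox hπ₀
  exact ⟨π, hπ, fun _ hπ' => hπ'.unique hlam.le hπ,
    fun _ => hπ.tendsto_measure_le_skorohodEDist hlam.le happrox hπ₀⟩
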